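/- Let $M$ be a smooth manifold (Hausdorff, second countable, without boundary) of dimension $n+1$, $n\ge 0$, with a smooth Lorentzian metric $g=\langle\cdot,\cdot\rangle$ of signature $(-,+,\dots,+)$. A global time function is a smooth function $t:M\to\mathbb{R}$ whose gradient is everywhere timelike ($\langle \operatorname{grad} t,\operatorname{grad} t\rangle<0$); its nonempty level sets $t^{-1}(a)$ are called time slices. Fix a time orientation of $(M,g)$; time functions are always taken to be compatible with it, that is, $-\operatorname{grad} t$ is future-pointing. A future-directed (resp. past-directed) causal curve is a smooth curve $c:I\to M$, $I\subset\mathbb{R}$ an interval, whose velocity is at each point either zero or non-spacelike ($\langle\dot c,\dot c\rangle\le 0$) and future-pointing (resp. past-pointing). The causal past $J^-(p)$ is the set of endpoints of past-directed causal curves $c:[a,b]\to M$ with $c(a)=p$. For $S\subset M$, the future domain of dependence $D^+(S)$ is the set of all $p\in M$ such that every past-inextendible causal curve starting at $p$ intersects $S$; here a past-directed causal curve $c:[a,b)\to M$ with $c(a)=p$ ($b\le+\infty$) is past-inextendible if $\lim_{s\to b}c(s)$ does not exist. The past domain of dependence $D^-(S)$ is defined in the same way with future-directed curves, and $D(S)=D^+(S)\cup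 D^-(S)$. $(M,g)$ is globally hyperbolic if there is a global time function $t$ such that $D(t^{-1}(a))=M$ for every $a\in t(M)$. Proposition. If $(M,g)$ is globally hyperbolic, $S\subset M$ is a time slice and $p\in D^+(S)$, then $D^+(S)\cap J^-(p)$ is compact. -/

import Mathlib

open Set Filter Topology Manifold
open scoped ContDiff

/-- A smooth Lorentzian metric on the smooth `(n+1)`-dimensional manifold `M`: a smooth symmetric
`2`-tensor field of signature `(-, +, …, +)`. The signature is expressed by the existence, in each
tangent space, of an orthonormal basis `e₀, …, eₙ` with `e₀` of square `-1` and the other vectors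
of square `+1` (in particular the form is nondegenerate, see `LorentzianMetric.nondegenerate`). -/
structure LorentzianMetric (n : ℕ) (M : Type*) [TopologicalSpace M]
    [ChartedSpace (EuclideanSpace ℝ (Fin (n + 1))) M] [IsManifold (𝓡 (n + 1)) ∞ M] where
  /-- The bilinear form on each tangent space. -/
  val (x : M) : TangentSpace (𝓡 (n + 1)) x →L[ℝ] TangentSpace (𝓡 (n + 1)) x →L[ℝ] ℝ
  symm (x : M) (v w : TangentSpace (𝓡 (n + 1)) x) : val x v w = val x w v
  signature (x : M) : ∃ e : Module.Basis (Fin (n + 1)) ℝ (TangentSpace (𝓡 (n + 1)) x),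
    ∀ i j, val x (e i) (e j) = if i = j then (if i = 0 then -1 else 1) else 0
  contMDiff : ContMDiff (𝓡 (n + 1))
    ((𝓡 (n + 1)).prod 𝓘(ℝ, EuclideanSpace ℝ (Fin (n + 1)) →L[ℝ]
      EuclideanSpace ℝ (Fin (n + 1)) →L[ℝ] ℝ)) ∞
    (fun x ↦ Bundle.TotalSpace.mk' (EuclideanSpace ℝ (Fin (n + 1)) →L[ℝ]
      EuclideanSpace ℝ (Fin (n + 1)) →L[ℝ] ℝ)
      (E := fun x : M ↦ TangentSpace (𝓡 (n + 1)) x →L[ℝ] TangentSpace (𝓡 (n + 1)) x →L[ℝ] ℝ)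
      x (val x))

/-- The velocity at the parameter `s` of a curve `c` defined on the interval `J` (one-sided at an
endpoint that belongs to `J`). -/
noncomputable def curveVelocity (n : ℕ) {M : Type*} [TopologicalSpace M]
    [ChartedSpace (EuclideanSpace ℝ (Fin (n + 1))) M]
    (c : ℝ → M) (J : Set ℝ) (s : ℝ) : TangentSpace (𝓡 (n + 1)) (c s) :=
  mfderivWithin 𝓘(ℝ, ℝ) (𝓡 (n + 1)) c J s (1 : ℝ)

namespace LorentzianMetric

variable {n : ℕ} {M : Type*} [TopologicalSpace M]
  [ChartedSpace (EuclideanSpace ℝ (Fin (n + 1))) M] [IsManifold (𝓡 (n + 1)) ∞ M]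

/-- The metric at `x` as an algebraic bilinear form. -/
noncomputable def bilin (g : LorentzianMetric n M) (x : M) :
    LinearMap.BilinForm ℝ (TangentSpace (𝓡 (n + 1)) x) :=
  LinearMap.mk₂ ℝ (fun v w ↦ g.val x v w) (by simp) (by simp) (by simp) (by simp)

@[simp]
theorem bilin_apply (g : LorentzianMetric n M) (x : M) (v w : TangentSpace (𝓡 (n + 1)) x) :
    g.bilin x v w = g.val x v w := rfl

theorem nondegenerate (g : LorentzianMetric n M) (x : M) : (g.bilin x).Nondegenerate := by
  obtain ⟨e, he⟩ := g.signature x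
  have key : ∀ v : TangentSpace (𝓡 (n + 1)) x, (∀ w, g.val x w v = 0) → v = 0 := by
    intro v hv
    refine (e.forall_coord_eq_zero_iff).1 fun i ↦ ?_
    have h := hv (e i)
    rw [← e.sum_repr v, map_sum] at h
    simp only [map_smul, he, smul_eq_mul] at h
    rw [Finset.sum_eq_single i (fun j _ hj ↦ by simp [hj.symm]) (by simp)] at h
    rw [Module.Basis.coord_apply]
    by_cases h0 : i = 0 <;> simpa [h0] using h
  refine ⟨fun v hv ↦ key v fun w ↦ ?_, fun v hv ↦ key v hv⟩
  rw [g.symm]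
  exact hv w

instance (x : M) : FiniteDimensional ℝ (TangentSpace (𝓡 (n + 1)) x) :=
  inferInstanceAs (FiniteDimensional ℝ (EuclideanSpace ℝ (Fin (n + 1))))

/-- The gradient at `x` of a real function `f`: the vector metrically dual to the differential of
`f` at `x`. -/
noncomputable def grad (g : LorentzianMetric n M) (f : M → ℝ) (x : M) :
    TangentSpace (𝓡 (n + 1)) x :=
  ((g.bilin x).toDual (g.nondegenerate x)).symm
    (ContinuousLinearMap.toLinearMap (mfderiv (𝓡 (n + 1)) 𝓘(ℝ, ℝ) f x))

theorem val_grad (g : LorentzianMetric n M) (f : M → ℝ) (x : M)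
    (w : TangentSpace (𝓡 (n + 1)) x) :
    g.val x (g.grad f x) w = mfderiv (𝓡 (n + 1)) 𝓘(ℝ, ℝ) f x w := by
  rw [← bilin_apply, grad, LinearMap.BilinForm.apply_toDual_symm_apply]
  rfl

/-- A tangent vector is timelike if its square is negative. -/
def IsTimelike (g : LorentzianMetric n M) {x : M} (v : TangentSpace (𝓡 (n + 1)) x) : Prop :=
  g.val x v v < 0

/-- A tangent vector is spacelike if its square is positive. -/
def IsSpacelike (g : LorentzianMetric n M) {x : M} (v : TangentSpace (𝓡 (n + 1)) x) : Prop :=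
  0 < g.val x v v

/-- A time orientation, given by a smooth timelike vector field. -/
structure TimeOrientation (g : LorentzianMetric n M) where
  /-- The vector field that defines the future. -/
  field (x : M) : TangentSpace (𝓡 (n + 1)) x
  timelike (x : M) : g.IsTimelike (field x)
  contMDiff : ContMDiff (𝓡 (n + 1)) (𝓡 (n + 1)).tangent ∞
    (fun x ↦ (⟨x, field x⟩ : TangentBundle (𝓡 (n + 1)) M))

namespace TimeOrientation

variable {g : LorentzianMetric n M}

/-- A nonzero non-spacelike vector is future-pointing if its product with the vector field that
defines the time orientation is negative. -/
def IsFuturePointing (O : g.TimeOrientation) {x : M} (v : TangentSpace (𝓡 (n + 1)) x) : Prop :=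
  v ≠ 0 ∧ ¬ g.IsSpacelike v ∧ g.val x (O.field x) v < 0

/-- A vector `v` is past-pointing if `-v` is future-pointing. -/
def IsPastPointing (O : g.TimeOrientation) {x : M} (v : TangentSpace (𝓡 (n + 1)) x) : Prop :=
  v ≠ 0 ∧ ¬ g.IsSpacelike v ∧ 0 < g.val x (O.field x) v

/-- Smooth future-directed causal curves defined on the interval `J`: the velocity is
non-spacelike, and it is future-pointing wherever it is nonzero. -/
def IsFutureCausalCurve (O : g.TimeOrientation) (c : ℝ → M) (J : Set ℝ) : Prop :=
  ContMDiffOn 𝓘(ℝ, ℝ) (𝓡 (n + 1)) ∞ c J ∧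
    ∀ s ∈ J, curveVelocity n c J s ≠ 0 → O.IsFuturePointing (curveVelocity n c J s)

/-- Smooth past-directed causal curves defined on the interval `J`. -/
def IsPastCausalCurve (O : g.TimeOrientation) (c : ℝ → M) (J : Set ℝ) : Prop :=
  ContMDiffOn 𝓘(ℝ, ℝ) (𝓡 (n + 1)) ∞ c J ∧
    ∀ s ∈ J, curveVelocity n c J s ≠ 0 → O.IsPastPointing (curveVelocity n c J s)

/-- The causal past `J⁻(p)`: all points to which `p` can be connected by a past-directed causal
curve. -/
def causalPast (O : g.TimeOrientation) (p : M) : Set M :=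
  {q | ∃ (c : ℝ → M) (a b : ℝ), a < b ∧ O.IsPastCausalCurve c (Icc a b) ∧ c a = p ∧ c b = q}

/-- The half-open interval `[a, b)`, where `b` may be `+∞`. -/
def halfOpen (a : ℝ) (b : EReal) : Set ℝ := {s : ℝ | a ≤ s ∧ (s : EReal) < b}

/-- The curve `c` has no limit as its parameter tends to `b` from the left (`b` may be `+∞`). -/
def HasNoLimitAt (c : ℝ → M) (b : EReal) : Prop :=
  ¬ ∃ q : M, Tendsto c (comap (fun s : ℝ ↦ (s : EReal)) (𝓝[<] b)) (𝓝 q)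

/-- The past domain of dependence `D⁻(S)`: all points `p` such that every future-inextendible
(future-directed) causal curve `c : [a, b) → M` starting at `p` intersects `S`. -/
def pastDomainOfDependence (O : g.TimeOrientation) (S : Set M) : Set M :=
  {p | ∀ (c : ℝ → M) (a : ℝ) (b : EReal), (a : EReal) < b →
    O.IsFutureCausalCurve c (halfOpen a b) → HasNoLimitAt c b → c a = p →
    ∃ s ∈ halfOpen a b, c s ∈ S}

/-- The future domain of dependence `D⁺(S)`: all points `p` such that every past-inextendible
(past-directed) causal curve `c : [a, b) → M` starting at `p` intersects `S`. -/
def futureDomainOfDependence (O : g.TimeOrientation) (S : Set M) : Set M :=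
  {p | ∀ (c : ℝ → M) (a : ℝ) (b : EReal), (a : EReal) < b →
    O.IsPastCausalCurve c (halfOpen a b) → HasNoLimitAt c b → c a = p →
    ∃ s ∈ halfOpen a b, c s ∈ S}

/-- The domain of dependence `D(S) = D⁺(S) ∪ D⁻(S)`. -/
def domainOfDependence (O : g.TimeOrientation) (S : Set M) : Set M :=
  O.futureDomainOfDependence S ∪ O.pastDomainOfDependence S

/-- A global time function: a smooth function with timelike gradient. The time orientation is the
one determined by `-grad t`, so that `t` increases along future-directed timelike curves. -/
def IsTimeFunction (O : g.TimeOrientation) (t : M → ℝ) : Prop :=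
  ContMDiff (𝓡 (n + 1)) 𝓘(ℝ, ℝ) ∞ t ∧
    ∀ x, g.IsTimelike (g.grad t x) ∧ O.IsFuturePointing (-(g.grad t x))

/-- The time slices are the nonempty level sets of global time functions. -/
def IsTimeSlice (O : g.TimeOrientation) (S : Set M) : Prop :=
  ∃ t : M → ℝ, O.IsTimeFunction t ∧ ∃ a ∈ range t, S = t ⁻¹' {a}

/-- Global hyperbolicity: there is a global time function all of whose time slices `t = a`, with
`a` in the range of `t`, have the whole of `M` as domain of dependence. -/
def IsGloballyHyperbolic (O : g.TimeOrientation) : Prop :=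
  ∃ t : M → ℝ, O.IsTimeFunction t ∧ ∀ a ∈ range t, O.domainOfDependence (t ⁻¹' {a}) = univ

end TimeOrientation

end LorentzianMetric

/-!
The compactness of `D⁺(S) ∩ J⁻(p)` for a level set `S = {t = τ}` of a time function rests on one
local fact: every point of `M` has a neighbourhood in which the relation "joined by a past-directed
causal curve that stays in the neighbourhood" has a closure that is still contained in the causal
relation and is strictly decreasing for `t` (`exists_nhds_causal_closed`).

*Local part.* It is proved in coordinates, for a `CoordMetric`. A `GeodesicBox` is a ball in which
any two points are joined by a unique short geodesic that depends on its endpoints in a Lipschitz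
way; it exists by the Picard-Lindelöf theorem and a perturbation of the identity
(`exists_geodesicBox`). The first variation formula (`IsGeodesic.first_variation`), with a quadratic
error term in place of a second derivative, gives the derivative along a curve of the energy of the
geodesics from a fixed base point to the points of the curve. Along a causal curve this derivative
is nonpositive as long as these geodesics are timelike and past-directed, so that they remain so
(`lagr_neg_of_causal`). Approximating an arbitrary point of the box by base points in its
chronological future, one sees that causally related points of the box are joined by causal
geodesics (`mem_causal_of_causallyJoined`). As geodesics depend continuously on their endpoints and
the causal cones are closed, limits of related pairs are again joined by causal geodesics. Time
functions decrease strictly along those.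

*Global part.* Let `B` be a closed set that contains `p`, and suppose that every point of `B` in the
past of `p` has an earlier point of `B` in its past. Choosing, step by step, points of `B` that gain
at least half of the possible decrease of the bounded function `arctan t`, and joining them by
causal curves, one gets a causal curve from `p` that has no limit: a limit would by the local fact
lie in the past of all points of the chain, and so would an earlier point of `B`, which is more than
the choice allows (`exists_inextendible_curve_through`).

Suppose now that an ultrafilter `𝓤` on `D⁺(S) ∩ J⁻(p)` has no limit there. Let `B` be the set of
those points `x` such that points arbitrarily near `x` have `𝓤`-many points in their past
(`limitFuture`). It is closed, contains `p` and lies in `{t ≥ τ}`, since so does `D⁺(S)`. For `x ∈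
B` in the past of `p`, the causal curves from points near `x` to `𝓤`-many points have to leave a
small compact neighbourhood of `x`, because `𝓤` does not converge to `x`. By the local fact, a limit
`x'` of their exit points is in the past of `x` and earlier than `x`, and it belongs to `B`
(`exists_lt_mem_limitFuture`). This limit argument replaces the limit curve lemma. The resulting
curve from `p` is past-inextendible, so it meets `S`; but it returns to `B` at earlier and earlier
times, while `B` lies in `{t ≥ τ}`: a contradiction.
-/

section

-- Instance problems for spaces of bilinear maps exceed the default depth.
set_option maxSynthPendingDepth 4

/-! ### Lorentzian metrics in coordinates -/

/-- A Lorentzian metric and a time function read in coordinates: a smooth field `g` of symmetric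
bilinear forms and a smooth function `τ` on an open set `Ω` of a vector space, such that `dτ` is
represented by a timelike vector and its kernel is spacelike. The last two conditions encode
the signature of `g`. -/
structure CoordMetric (E : Type*) [NormedAddCommGroup E] [NormedSpace ℝ E] where
  /-- The coordinate domain. -/
  Ω : Set E
  /-- The metric coefficients. -/
  g : E → E →L[ℝ] E →L[ℝ] ℝ
  /-- The time function. -/
  τ : E → ℝ
  isOpen : IsOpen Ω
  contDiffOn_g : ContDiffOn ℝ ∞ g Ω
  contDiffOn_τ : ContDiffOn ℝ ∞ τ Ω
  symm : ∀ y ∈ Ω, ∀ v w, g y v w = g y w v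
  pos : ∀ y ∈ Ω, ∀ v, fderiv ℝ τ y v = 0 → v ≠ 0 → 0 < g y v v
  grad : ∀ y ∈ Ω, ∃ N, (∀ w, g y N w = fderiv ℝ τ y w) ∧ g y N N < 0


namespace CoordMetric

variable {E : Type*} [NormedAddCommGroup E] [NormedSpace ℝ E] (D : CoordMetric E)

/-- The closed cone of past-pointing causal vectors, including `0`. -/
def cone (y : E) : Set E := {v | D.g y v v ≤ 0 ∧ fderiv ℝ D.τ y v ≤ 0}

variable {D}

theorem nonpos_of_mem_cone {y u v : E} (hy : y ∈ D.Ω) (hu : D.g y u u < 0)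
    (hu' : fderiv ℝ D.τ y u < 0) (hv : v ∈ D.cone y) : D.g y u v ≤ 0 := by
  by_contra! h
  obtain ⟨hv1, hv2⟩ := hv
  -- the combination of `u` and `v` that is annihilated by `dτ`
  have key := D.pos y hy (fderiv ℝ D.τ y v • u - fderiv ℝ D.τ y u • v)
    (by simp; ring)
  have hexp : D.g y (fderiv ℝ D.τ y v • u - fderiv ℝ D.τ y u • v)
      (fderiv ℝ D.τ y v • u - fderiv ℝ D.τ y u • v)
      = fderiv ℝ D.τ y v ^ 2 * D.g y u u
        - 2 * (fderiv ℝ D.τ y v * fderiv ℝ D.τ y u) * D.g y u v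
        + fderiv ℝ D.τ y u ^ 2 * D.g y v v := by
    simp only [map_sub, map_smul, sub_apply, smul_apply,
      smul_eq_mul, D.symm y hy v u]
    ring
  rcases hv2.lt_or_eq with hlt | heq
  · have h1 : fderiv ℝ D.τ y v ^ 2 * D.g y u u < 0 := mul_neg_of_pos_of_neg (sq_pos_of_neg hlt) hu
    have h2 : 0 < fderiv ℝ D.τ y v * fderiv ℝ D.τ y u * D.g y u v :=
      mul_pos (mul_pos_of_neg_of_neg hlt hu') h
    have h3 : fderiv ℝ D.τ y u ^ 2 * D.g y v v ≤ 0 :=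
      mul_nonpos_of_nonneg_of_nonpos (by positivity) hv1
    have h4 := key (fun h0 ↦ by rw [h0] at hexp; simp at hexp; nlinarith)
    nlinarith
  · have hv0 : v = 0 := by
      by_contra h0
      exact absurd (D.pos y hy v heq h0) (not_lt.2 hv1)
    simp [hv0] at h

theorem dτ_ne_zero {y v : E} (hy : y ∈ D.Ω) (hv : D.g y v v ≤ 0) (h0 : v ≠ 0) :
    fderiv ℝ D.τ y v ≠ 0 :=
  fun h ↦ absurd (D.pos y hy v h h0) (not_lt.2 hv)

theorem isInvertible [FiniteDimensional ℝ E] {y : E} (hy : y ∈ D.Ω) : (D.g y).IsInvertible := by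
  have hinj : Function.Injective (D.g y) := by
    rw [injective_iff_map_eq_zero]
    intro v hv
    obtain ⟨N, hN, -⟩ := D.grad y hy
    by_contra h0
    have h1 := D.pos y hy v (by rw [← hN, D.symm y hy, hv]; simp) h0
    simp [hv] at h1
  let e := LinearEquiv.ofInjectiveOfFinrankEq (D.g y : E →ₗ[ℝ] E →L[ℝ] ℝ) hinj
    ((Subspace.dual_finrank_eq (K := ℝ) (V := E)).symm.trans
      (LinearMap.toContinuousLinearMap (𝕜 := ℝ) (E := E) (F' := ℝ)).finrank_eq)
  exact ⟨e.toContinuousLinearEquiv, by ext; rfl⟩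

variable (D)

/-- The acceleration of the geodesic through `x` with velocity `v`. It is the vector that
represents the covector `½ Dg(·)(v, v) - Dg(v)(v, ·)`. -/
noncomputable def accel (x v : E) : E :=
  (D.g x).inverse ((1 / 2 : ℝ) • ((fderiv ℝ D.g x).flip v).flip v - fderiv ℝ D.g x v v)

/-- The geodesic vector field on the tangent bundle. -/
noncomputable def spray (p : E × E) : E × E := (p.2, D.accel p.1 p.2)

/-- The Lagrangian `½ g(v, v)`. -/
noncomputable def lagr (p : E × E) : ℝ := (1 / 2 : ℝ) * D.g p.1 p.2 p.2

variable {D}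

theorem g_accel [FiniteDimensional ℝ E] {x : E} (hx : x ∈ D.Ω) (v w : E) :
    D.g x (D.accel x v) w = (1 / 2 : ℝ) * fderiv ℝ D.g x w v v - fderiv ℝ D.g x v v w := by
  rw [accel, (isInvertible hx).self_apply_inverse]
  simp

theorem contDiffOn_fderiv_g : ContDiffOn ℝ ∞ (fderiv ℝ D.g) D.Ω :=
  D.contDiffOn_g.fderiv_of_isOpen D.isOpen (by simp)

theorem contDiffOn_spray [FiniteDimensional ℝ E] : ContDiffOn ℝ ∞ D.spray (D.Ω ×ˢ univ) := by
  have hf : ContDiffOn ℝ ∞ (Prod.fst : E × E → E) (D.Ω ×ˢ univ) := contDiffOn_fst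
  have hs : ContDiffOn ℝ ∞ (Prod.snd : E × E → E) (D.Ω ×ˢ univ) := contDiffOn_snd
  have hg' : ContDiffOn ℝ ∞ (fun p : E × E ↦ fderiv ℝ D.g p.1) (D.Ω ×ˢ univ) :=
    contDiffOn_fderiv_g.comp hf (fun p hp ↦ hp.1)
  have hg : ContDiffOn ℝ ∞ (fun p : E × E ↦ D.g p.1) (D.Ω ×ˢ univ) :=
    D.contDiffOn_g.comp hf (fun p hp ↦ hp.1)
  have hinv : ContDiffOn ℝ ∞ (fun p : E × E ↦ (D.g p.1).inverse) (D.Ω ×ˢ univ) := fun p hp ↦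
    ContDiffAt.comp_contDiffWithinAt (g := ContinuousLinearMap.inverse) p
      (isInvertible hp.1).contDiffAt_map_inverse (hg p hp)
  have hflip : ContDiffOn ℝ ∞ (fun p : E × E ↦ ((fderiv ℝ D.g p.1).flip p.2).flip p.2)
      (D.Ω ×ˢ univ) := by
    rw [contDiffOn_clm_apply]
    intro w
    exact ((hg'.clm_apply contDiffOn_const).clm_apply hs).clm_apply hs
  have h1 : ContDiffOn ℝ ∞ (fun p : E × E ↦
      (1 / 2 : ℝ) • ((fderiv ℝ D.g p.1).flip p.2).flip p.2) (D.Ω ×ˢ univ) :=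
    hflip.const_smul (1 / 2 : ℝ)
  exact hs.prodMk (hinv.clm_apply (h1.sub ((hg'.clm_apply hs).clm_apply hs)))

theorem accel_neg (x v : E) : D.accel x (-v) = D.accel x v := by
  unfold accel
  congr 1
  ext w
  simp

theorem accel_zero (x : E) : D.accel x 0 = 0 := by simp [accel]

theorem contDiffOn_lagr : ContDiffOn ℝ ∞ D.lagr (D.Ω ×ˢ univ) := by
  have hg : ContDiffOn ℝ ∞ (fun p : E × E ↦ D.g p.1) (D.Ω ×ˢ univ) :=
    D.contDiffOn_g.comp contDiffOn_fst (fun p hp ↦ hp.1)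
  exact contDiffOn_const.mul ((hg.clm_apply contDiffOn_snd).clm_apply contDiffOn_snd)

theorem hasFDerivAt_g {x : E} (hx : x ∈ D.Ω) : HasFDerivAt D.g (fderiv ℝ D.g x) x :=
  ((D.contDiffOn_g.contDiffAt (D.isOpen.mem_nhds hx)).differentiableAt (by simp)).hasFDerivAt

theorem hasFDerivAt_τ {x : E} (hx : x ∈ D.Ω) : HasFDerivAt D.τ (fderiv ℝ D.τ x) x :=
  ((D.contDiffOn_τ.contDiffAt (D.isOpen.mem_nhds hx)).differentiableAt (by simp)).hasFDerivAt

theorem continuousOn_fderiv_τ : ContinuousOn (fderiv ℝ D.τ) D.Ω :=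
  D.contDiffOn_τ.continuousOn_fderiv_of_isOpen D.isOpen (by simp)

theorem hasFDerivAt_lagr {p : E × E} (hp : p.1 ∈ D.Ω) :
    HasFDerivAt D.lagr (fderiv ℝ D.lagr p) p :=
  ((contDiffOn_lagr.contDiffAt
    ((D.isOpen.prod isOpen_univ).mem_nhds ⟨hp, trivial⟩)).differentiableAt (by simp)).hasFDerivAt

theorem fderiv_lagr {p : E × E} (hp : p.1 ∈ D.Ω) (η : E × E) :
    fderiv ℝ D.lagr p η = (1 / 2 : ℝ) * fderiv ℝ D.g p.1 η.1 p.2 p.2 + D.g p.1 p.2 η.2 := by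
  have h1 : HasFDerivAt (fun p : E × E ↦ D.g p.1)
      ((fderiv ℝ D.g p.1).comp (ContinuousLinearMap.fst ℝ E E)) p :=
    HasFDerivAt.comp (g := D.g) p (hasFDerivAt_g hp) hasFDerivAt_fst
  have h2 := ((h1.clm_apply hasFDerivAt_snd).clm_apply hasFDerivAt_snd).const_mul (1 / 2 : ℝ)
  have h3 : fderiv ℝ D.lagr p = _ := h2.fderiv
  rw [h3]
  simp [D.symm p.1 hp η.2 p.2]
  ring

/-- The Lagrangian is constant along the geodesic vector field. -/
theorem fderiv_lagr_spray [FiniteDimensional ℝ E] {p : E × E} (hp : p.1 ∈ D.Ω) :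
    fderiv ℝ D.lagr p (D.spray p) = 0 := by
  rw [fderiv_lagr hp]
  simp only [spray]
  rw [D.symm p.1 hp, g_accel hp]
  ring

end CoordMetric

/-! ### Short geodesics in a geodesic box -/

namespace CoordMetric

variable {E : Type*} [NormedAddCommGroup E] [NormedSpace ℝ E] {D : CoordMetric E}

variable (D) in
/-- `Φ : [0, ε] → K` is an integral curve of the geodesic vector field, that is, a geodesic together
with its velocity. -/
def IsGeodesicOn (K : Set (E × E)) (ε : ℝ) (Φ : ℝ → E × E) : Prop :=
  ∀ s ∈ Icc 0 ε, HasDerivWithinAt Φ (D.spray (Φ s)) (Icc 0 ε) s ∧ Φ s ∈ K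

variable (D) in
/-- A neighbourhood of `x₀` in which any two points are joined by a unique short geodesic, which
depends on them in a Lipschitz way. Geodesics are parametrized by `[0, ε]`, and they stay, with
their velocities, in a ball of radius `R` of the phase space. -/
structure GeodesicBox (x₀ : E) where
  /-- The radius of the ball of the phase space that contains the geodesics. -/
  R : ℝ
  /-- The length of the parameter interval. -/
  ε : ℝ
  /-- The radius of the ball of initial values for which geodesics exist. -/
  r : ℝ
  /-- A bound for the Lipschitz constants. -/
  Λ : ℝ
  /-- The radius of the ball in which points are joined by geodesics. -/
  ρ : ℝ
  ε_pos : 0 < ε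
  r_pos : 0 < r
  Λ_pos : 0 < Λ
  ρ_pos : 0 < ρ
  ρ_le : ρ ≤ r
  r_le : r ≤ R
  subset : Metric.closedBall x₀ R ⊆ D.Ω
  lipschitz : ∃ L, LipschitzOnWith L D.spray (Metric.closedBall (x₀, 0) R)
  exists_geodesic : ∀ p ∈ Metric.closedBall ((x₀, 0) : E × E) r,
    ∃ Φ, D.IsGeodesicOn (Metric.closedBall (x₀, 0) R) ε Φ ∧ Φ 0 = p
  norm_sub_le_initial : ∀ Φ Ψ, D.IsGeodesicOn (Metric.closedBall (x₀, 0) R) ε Φ →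
    D.IsGeodesicOn (Metric.closedBall (x₀, 0) R) ε Ψ →
    ∀ s ∈ Icc 0 ε, ‖Φ s - Ψ s‖ ≤ Λ * ‖Φ 0 - Ψ 0‖
  norm_sub_le_ends : ∀ Φ Ψ, D.IsGeodesicOn (Metric.closedBall (x₀, 0) R) ε Φ →
    D.IsGeodesicOn (Metric.closedBall (x₀, 0) R) ε Ψ →
    ∀ s ∈ Icc 0 ε, ‖Φ s - Ψ s‖ ≤ Λ * (‖(Φ ε).1 - (Ψ ε).1‖ + ‖(Φ 0).1 - (Ψ 0).1‖)
  taylor : ∀ p ∈ Metric.closedBall ((x₀, 0) : E × E) R, ∀ q ∈ Metric.closedBall (x₀, 0) R,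
    |D.lagr q - D.lagr p - fderiv ℝ D.lagr p (q - p)| ≤ Λ * ‖q - p‖ ^ 2
  joined : ∀ z ∈ Metric.ball x₀ ρ, ∀ y ∈ Metric.ball x₀ ρ,
    ∃ Φ, D.IsGeodesicOn (Metric.closedBall (x₀, 0) R) ε Φ ∧ (Φ 0).1 = z ∧ (Φ ε).1 = y

theorem spray_zero (x : E) : D.spray (x, 0) = 0 := by simp [spray, accel_zero]

namespace IsGeodesicOn

variable {K : Set (E × E)} {ε : ℝ} {Φ Ψ : ℝ → E × E}

theorem continuousOn (h : D.IsGeodesicOn K ε Φ) : ContinuousOn Φ (Icc 0 ε) :=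
  fun s hs ↦ (h s hs).1.continuousWithinAt

theorem hasDerivWithinAt_Ici (h : D.IsGeodesicOn K ε Φ) {s : ℝ} (hs : s ∈ Ico 0 ε) :
    HasDerivWithinAt Φ (D.spray (Φ s)) (Ici s) s :=
  (h s (Ico_subset_Icc_self hs)).1.mono_of_mem_nhdsWithin (Icc_mem_nhdsGE_of_mem hs)

theorem norm_sub_le {L : NNReal} (hL : LipschitzOnWith L D.spray K) (hε : L * ε ≤ 1 / 4)
    (hΦ : D.IsGeodesicOn K ε Φ) (hΨ : D.IsGeodesicOn K ε Ψ) {s : ℝ} (hs : s ∈ Icc 0 ε) :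
    ‖Φ s - Ψ s‖ ≤ 2 * ‖Φ 0 - Ψ 0‖ := by
  have h := dist_le_of_trajectories_ODE_of_mem (v := fun _ ↦ D.spray) (s := fun _ ↦ K) (K := L)
    (fun _ _ ↦ hL) hΦ.continuousOn (fun _ ht ↦ hΦ.hasDerivWithinAt_Ici ht)
    (fun t ht ↦ (hΦ t (Ico_subset_Icc_self ht)).2) hΨ.continuousOn
    (fun _ ht ↦ hΨ.hasDerivWithinAt_Ici ht)
    (fun t ht ↦ (hΨ t (Ico_subset_Icc_self ht)).2) le_rfl s hs
  rw [dist_eq_norm, dist_eq_norm] at h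
  have hexp : Real.exp (L * (s - 0)) ≤ 2 := by
    have h1 : (L : ℝ) * (s - 0) ≤ 1 / 4 := by
      refine le_trans ?_ hε
      gcongr
      linarith [hs.2]
    have h2 : Real.exp (1 / 4) ≤ 2 := by
      have h3 := Real.exp_bound_div_one_sub_of_interval (x := 1 / 4) (by norm_num) (by norm_num)
      norm_num at h3 ⊢
      linarith
    exact (Real.exp_le_exp.2 h1).trans h2
  calc _ ≤ ‖Φ 0 - Ψ 0‖ * Real.exp (L * (s - 0)) := h
    _ ≤ ‖Φ 0 - Ψ 0‖ * 2 := by gcongr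
    _ = _ := by ring

/-- Short geodesics are straight up to first order, in a Lipschitz sense. -/
theorem norm_fst_sub_le {L : NNReal} (hL : LipschitzOnWith L D.spray K) (hε : L * ε ≤ 1 / 4)
    (h0 : 0 ≤ ε) (hΦ : D.IsGeodesicOn K ε Φ) (hΨ : D.IsGeodesicOn K ε Ψ) :
    ‖((Φ ε).1 - (Ψ ε).1) - ((Φ 0).1 - (Ψ 0).1) - ε • ((Φ 0).2 - (Ψ 0).2)‖
      ≤ ε / 2 * ‖Φ 0 - Ψ 0‖ := by
  set d := ‖Φ 0 - Ψ 0‖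
  have hder : ∀ s ∈ Icc 0 ε, HasDerivWithinAt (fun s ↦ Φ s - Ψ s)
      (D.spray (Φ s) - D.spray (Ψ s)) (Icc 0 ε) s := fun s hs ↦ (hΦ s hs).1.sub (hΨ s hs).1
  have hbd : ∀ s ∈ Icc 0 ε, ‖D.spray (Φ s) - D.spray (Ψ s)‖ ≤ L * (2 * d) := fun s hs ↦ by
    have := hL.dist_le_mul _ (hΦ s hs).2 _ (hΨ s hs).2
    rw [dist_eq_norm, dist_eq_norm] at this
    exact this.trans (by gcongr; exact norm_sub_le hL hε hΦ hΨ hs)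
  have hvel : ∀ s ∈ Icc 0 ε, ‖((Φ s).2 - (Ψ s).2) - ((Φ 0).2 - (Ψ 0).2)‖ ≤ d / 2 := fun s hs ↦ by
    have h1 := norm_image_sub_le_of_norm_deriv_le_segment' hder
      (fun x hx ↦ hbd x (Ico_subset_Icc_self hx)) s hs
    have h2 : ‖((Φ s).2 - (Ψ s).2) - ((Φ 0).2 - (Ψ 0).2)‖ ≤ ‖(Φ s - Ψ s) - (Φ 0 - Ψ 0)‖ := by
      simpa using norm_snd_le ((Φ s - Ψ s) - (Φ 0 - Ψ 0))
    refine h2.trans (h1.trans ?_)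
    calc L * (2 * d) * (s - 0) ≤ L * (2 * d) * ε := by gcongr; linarith [hs.2]
      _ = (L * ε) * (2 * d) := by ring
      _ ≤ 1 / 4 * (2 * d) := by gcongr
      _ = d / 2 := by ring
  have hder' : ∀ s ∈ Icc 0 ε, HasDerivWithinAt
      (fun s ↦ ((Φ s).1 - (Ψ s).1) - s • ((Φ 0).2 - (Ψ 0).2))
      (((Φ s).2 - (Ψ s).2) - ((Φ 0).2 - (Ψ 0).2)) (Icc 0 ε) s := fun s hs ↦ by
    have h1 : HasDerivWithinAt (fun s ↦ (Φ s).1 - (Ψ s).1) ((Φ s).2 - (Ψ s).2) (Icc 0 ε) s := by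
      simpa [spray] using!
        (ContinuousLinearMap.fst ℝ E E).hasFDerivAt.comp_hasDerivWithinAt s (hder s hs)
    have h2 := (hasDerivWithinAt_id s (Icc 0 ε)).smul_const ((Φ 0).2 - (Ψ 0).2)
    simpa using! h1.sub h2
  have h3 := norm_image_sub_le_of_norm_deriv_le_segment' hder'
      (fun x hx ↦ hvel x (Ico_subset_Icc_self hx)) ε ⟨h0, le_rfl⟩
  calc _ = _ := by congr 1; simp; abel
    _ ≤ d / 2 * (ε - 0) := h3
    _ = _ := by ring

end IsGeodesicOn

/-- The endpoints of a short geodesic determine it, in a Lipschitz way. -/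
theorem IsGeodesicOn.norm_sub_le_ends {K : Set (E × E)} {ε : ℝ} {Φ Ψ : ℝ → E × E} {L : NNReal}
    (hL : LipschitzOnWith L D.spray K) (hε : L * ε ≤ 1 / 4) (h0 : 0 < ε) (h1 : ε ≤ 1)
    (hΦ : D.IsGeodesicOn K ε Φ) (hΨ : D.IsGeodesicOn K ε Ψ) {s : ℝ} (hs : s ∈ Icc 0 ε) :
    ‖Φ s - Ψ s‖ ≤ 8 / ε * (‖(Φ ε).1 - (Ψ ε).1‖ + ‖(Φ 0).1 - (Ψ 0).1‖) := by
  have h2 := IsGeodesicOn.norm_sub_le hL hε hΦ hΨ hs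
  have h3 := IsGeodesicOn.norm_fst_sub_le hL hε h0.le hΦ hΨ
  set a := ‖(Φ ε).1 - (Ψ ε).1‖
  set b := ‖(Φ 0).1 - (Ψ 0).1‖
  set c := ‖(Φ 0).2 - (Ψ 0).2‖
  have hd : ‖Φ 0 - Ψ 0‖ = max b c := by rw [Prod.norm_def]; rfl
  have hb : 0 ≤ b := norm_nonneg _
  have hc : 0 ≤ c := norm_nonneg _
  have ha : 0 ≤ a := norm_nonneg _
  have h4 : ε * c ≤ a + b + ε / 2 * (b + c) := by
    have h5 : ε * c = ‖ε • ((Φ 0).2 - (Ψ 0).2)‖ := by rw [norm_smul, Real.norm_of_nonneg h0.le]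
    have h6 : ‖ε • ((Φ 0).2 - (Ψ 0).2)‖ ≤
        ‖((Φ ε).1 - (Ψ ε).1) - ((Φ 0).1 - (Ψ 0).1) - ε • ((Φ 0).2 - (Ψ 0).2)‖
          + (‖(Φ ε).1 - (Ψ ε).1‖ + ‖(Φ 0).1 - (Ψ 0).1‖) := by
      rw [← norm_sub_rev (ε • ((Φ 0).2 - (Ψ 0).2))]
      refine le_trans ?_ (add_le_add_right (_root_.norm_sub_le _ _) _)
      refine le_trans (le_of_eq ?_) (norm_add_le _ _)
      congr 1; abel
    have h7 : max b c ≤ b + c := max_le (by linarith) (by linarith)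
    have h8 : ε / 2 * max b c ≤ ε / 2 * (b + c) := by gcongr
    rw [hd] at h3
    linarith
  have h9 : max b c ≤ 4 / ε * (a + b) := by
    rw [div_mul_eq_mul_div, le_div_iff₀ h0]
    refine le_trans (b := max b c * ε) le_rfl ?_
    rcases max_cases b c with h | h <;> rw [h.1] <;> nlinarith
  rw [hd] at h2
  calc _ ≤ 2 * max b c := h2
    _ ≤ 2 * (4 / ε * (a + b)) := by gcongr
    _ = _ := by ring

end CoordMetric

/-! ### Existence of geodesic boxes -/

/-- The solutions given by the Picard-Lindelöf theorem stay in the given ball. -/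
theorem exists_solution_mem_closedBall_of_isPicardLindelof {F : Type*} [NormedAddCommGroup F]
    [NormedSpace ℝ F] [CompleteSpace F] {f : ℝ → F → F} {tmin tmax : ℝ} {t₀ : Icc tmin tmax}
    {p₀ p : F} {a r L K : NNReal} (hf : IsPicardLindelof f t₀ p₀ a r L K)
    (hp : p ∈ Metric.closedBall p₀ r) :
    ∃ α : ℝ → F, α t₀ = p ∧ ∀ t ∈ Icc tmin tmax,
      HasDerivWithinAt α (f t (α t)) (Icc tmin tmax) t ∧ α t ∈ Metric.closedBall p₀ a := by
  obtain ⟨α, hα⟩ := ODE.FunSpace.exists_isFixedPt_next hf hp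
  refine ⟨α.compProj, by rw [ODE.FunSpace.compProj_val, ← hα, ODE.FunSpace.next_apply₀],
    fun t ht ↦ ⟨?_, α.compProj_mem_closedBall hf.mul_max_le⟩⟩
  apply ODE.hasDerivWithinAt_picard_Icc t₀.2 hf.continuousOn_uncurry
    α.continuous_compProj.continuousOn (fun _ ht' ↦ α.compProj_mem_closedBall hf.mul_max_le)
    p ht |>.congr_of_mem _ ht
  intro t' ht'
  nth_rw 1 [← hα]
  rw [ODE.FunSpace.compProj_of_mem ht', ODE.FunSpace.next_apply]

/-- Solutions of an autonomous differential equation that stay in a given ball. -/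
theorem exists_solution_mem_closedBall {F : Type*} [NormedAddCommGroup F] [NormedSpace ℝ F]
    [CompleteSpace F] {f : F → F} {p₀ : F} {R C : ℝ} {L : NNReal} (hR : 0 ≤ R)
    (hL : LipschitzOnWith L f (Metric.closedBall p₀ R))
    (hC : ∀ p ∈ Metric.closedBall p₀ R, ‖f p‖ ≤ C) {ε : ℝ} (hε : 0 ≤ ε) (hC0 : 0 ≤ C)
    (hCε : C * ε ≤ R / 2) {p : F} (hp : p ∈ Metric.closedBall p₀ (R / 2)) :
    ∃ Φ : ℝ → F, Φ 0 = p ∧ ∀ s ∈ Icc 0 ε, HasDerivWithinAt Φ (f (Φ s)) (Icc 0 ε) s ∧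
      Φ s ∈ Metric.closedBall p₀ R := by
  lift R to NNReal using hR
  lift C to NNReal using hC0
  have h0 : (0 : ℝ) ∈ Icc 0 ε := ⟨le_rfl, hε⟩
  have hPL : IsPicardLindelof (fun _ ↦ f) (tmin := 0) (tmax := ε) ⟨0, h0⟩ p₀ R (R / 2) C L := by
    refine IsPicardLindelof.of_time_independent hC hL ?_
    simp only [sub_zero]
    rw [max_eq_left hε]
    push_cast
    linarith
  exact exists_solution_mem_closedBall_of_isPicardLindelof hPL (by push_cast; exact hp)

/-- A Lipschitz perturbation of a multiple of the identity covers a ball. -/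
theorem surjOn_closedBall_of_norm_sub_smul_le {E : Type*} [NormedAddCommGroup E] [NormedSpace ℝ E]
    [CompleteSpace E] {f : E → E} {ε r : ℝ} (hε : 0 < ε)
    (hr : 0 ≤ r)
    (h : ∀ v ∈ Metric.closedBall (0 : E) r, ∀ w ∈ Metric.closedBall (0 : E) r,
      ‖f v - f w - ε • (v - w)‖ ≤ ε / 2 * ‖v - w‖) :
    SurjOn f (Metric.closedBall 0 r) (Metric.closedBall (f 0) (ε / 2 * r)) := by
  lift ε to NNReal using hε.le
  have happ : ApproximatesLinearOn f ((ε : ℝ) • ContinuousLinearMap.id ℝ E)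
      (Metric.closedBall 0 r) (ε / 2) := by
    intro v hv w hw
    simpa using! h v hv w hw
  let S : ((ε : ℝ) • ContinuousLinearMap.id ℝ E).NonlinearRightInverse :=
    { toFun := fun y ↦ (ε : ℝ)⁻¹ • y
      nnnorm := ε⁻¹
      bound' := fun y ↦ by
        rw [norm_smul, Real.norm_of_nonneg (by positivity)]; simp
      right_inv' := fun y ↦ by simp [smul_smul, hε.ne'] }
  have := happ.surjOn_closedBall_of_nonlinearRightInverse S hr subset_rfl
  have h2 : ((S.nnnorm : ℝ)⁻¹ - ((ε / 2 : NNReal) : ℝ)) = ε / 2 := by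
    have : S.nnnorm = ε⁻¹ := rfl
    rw [this]
    push_cast
    rw [inv_inv]
    ring
  rwa [h2] at this

/-- A function with Lipschitz derivative on a ball is approximated by its first-order expansion. -/
theorem abs_taylor_le {F : Type*} [NormedAddCommGroup F] [NormedSpace ℝ F] {f : F → ℝ} {K : Set F}
    (hK : Convex ℝ K) (hf : ∀ p ∈ K, HasFDerivAt f (fderiv ℝ f p) p) {L : NNReal}
    (hL : LipschitzOnWith L (fderiv ℝ f) K) {p q : F} (hp : p ∈ K) (hq : q ∈ K) :
    |f q - f p - fderiv ℝ f p (q - p)| ≤ L * ‖q - p‖ ^ 2 := by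
  have hseg : segment ℝ p q ⊆ K := hK.segment_subset hp hq
  have := (convex_segment p q).norm_image_sub_le_of_norm_hasFDerivWithin_le' (f := f)
    (f' := fderiv ℝ f) (φ := fderiv ℝ f p) (C := L * ‖q - p‖)
    (fun x hx ↦ (hf x (hseg hx)).hasFDerivWithinAt) (fun x hx ↦ ?_)
    (left_mem_segment ℝ p q) (right_mem_segment ℝ p q)
  · rw [Real.norm_eq_abs] at this
    rw [sq, ← mul_assoc]
    exact this
  · have h1 := hL.dist_le_mul _ (hseg hx) _ hp
    rw [dist_eq_norm, dist_eq_norm] at h1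
    refine h1.trans ?_
    gcongr
    exact norm_sub_le_of_mem_segment hx

namespace CoordMetric

variable {E : Type*} [NormedAddCommGroup E] [NormedSpace ℝ E] {D : CoordMetric E}

/-- Around every point of the coordinate domain there is a geodesic box. -/
theorem exists_geodesicBox [FiniteDimensional ℝ E] {x₀ : E} (hx₀ : x₀ ∈ D.Ω) :
    Nonempty (D.GeodesicBox x₀) := by
  have : CompleteSpace E := FiniteDimensional.complete ℝ E
  have hopen : D.Ω ×ˢ (univ : Set E) ∈ 𝓝 ((x₀, 0) : E × E) :=
    (D.isOpen.prod isOpen_univ).mem_nhds ⟨hx₀, trivial⟩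
  have hspray : ContDiffAt ℝ 1 D.spray (x₀, 0) :=
    (contDiffOn_spray.contDiffAt hopen).of_le (by simp)
  have hlagr : ContDiffAt ℝ 1 (fderiv ℝ D.lagr) (x₀, 0) :=
    ((contDiffOn_lagr.fderiv_of_isOpen (D.isOpen.prod isOpen_univ) (m := ∞)
      (by simp)).contDiffAt hopen).of_le (by simp)
  obtain ⟨L, t₁, ht₁, hL⟩ := hspray.exists_lipschitzOnWith
  obtain ⟨L', t₂, ht₂, hL'⟩ := hlagr.exists_lipschitzOnWith
  obtain ⟨R, hR, hball⟩ := Metric.nhds_basis_closedBall.mem_iff.1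
    (inter_mem (inter_mem ht₁ ht₂) hopen)
  set K := Metric.closedBall ((x₀, 0) : E × E) R with hKdef
  replace hL : LipschitzOnWith L D.spray K := hL.mono fun p hp ↦ (hball hp).1.1
  replace hL' : LipschitzOnWith L' (fderiv ℝ D.lagr) K := hL'.mono fun p hp ↦ (hball hp).1.2
  have hΩ : ∀ p ∈ K, p.1 ∈ D.Ω := fun p hp ↦ (hball hp).2.1
  set ε : ℝ := 1 / (4 * (L + 1)) with hεdef
  have hε : 0 < ε := by positivity
  have hLε : L * ε ≤ 1 / 4 := by
    rw [hεdef, mul_one_div, div_le_div_iff₀ (by positivity) (by norm_num)]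
    linarith
  have hε1 : ε ≤ 1 := by
    rw [hεdef, div_le_one (by positivity)]
    nlinarith [L.coe_nonneg]
  have hbound : ∀ p ∈ K, ‖D.spray p‖ ≤ L * R := fun p hp ↦ by
    have h1 := hL.dist_le_mul _ hp _ (Metric.mem_closedBall_self hR.le)
    rw [spray_zero, dist_zero_right] at h1
    exact h1.trans (by gcongr; exact hp)
  have hex : ∀ p ∈ Metric.closedBall ((x₀, 0) : E × E) (R / 2),
      ∃ Φ, D.IsGeodesicOn K ε Φ ∧ Φ 0 = p := fun p hp ↦ by
    obtain ⟨Φ, h0, h⟩ := exists_solution_mem_closedBall hR.le hL hbound hε.le (by positivity)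
      (by nlinarith) hp
    exact ⟨Φ, h, h0⟩
  have hends := fun Φ Ψ (hΦ : D.IsGeodesicOn K ε Φ) (hΨ : D.IsGeodesicOn K ε Ψ) s hs ↦
    IsGeodesicOn.norm_sub_le_ends hL hLε hε hε1 hΦ hΨ (s := s) hs
  refine ⟨⟨R, ε, R / 2, 8 / ε + 2 + L', ε * (R / 2) / 4, hε, by positivity, by positivity,
    by positivity, by nlinarith, by linarith, fun y hy ↦ ?_, ⟨L, hL⟩, hex, fun Φ Ψ hΦ hΨ s hs ↦ ?_,
    fun Φ Ψ hΦ hΨ s hs ↦ ?_, fun p hp q hq ↦ ?_, fun z hz y hy ↦ ?_⟩⟩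
  · exact hΩ (y, 0) (by simpa [hKdef, Prod.dist_eq, hR.le] using hy)
  · refine (IsGeodesicOn.norm_sub_le hL hLε hΦ hΨ hs).trans ?_
    gcongr
    have : 0 ≤ 8 / ε := by positivity
    linarith [L'.coe_nonneg]
  · refine (hends Φ Ψ hΦ hΨ s hs).trans ?_
    gcongr
    linarith [L'.coe_nonneg]
  · refine (abs_taylor_le (convex_closedBall _ _) (fun p hp ↦ hasFDerivAt_lagr (hΩ p hp)) hL'
      hp hq).trans ?_
    gcongr
    have : 0 ≤ 8 / ε := by positivity
    linarith
  · have hz' : dist z x₀ ≤ R / 2 := (Metric.mem_ball.1 hz).le.trans (by nlinarith)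
    have hex' : ∀ w : E, ∃ Φ, w ∈ Metric.closedBall (0 : E) (R / 2) →
        D.IsGeodesicOn K ε Φ ∧ Φ 0 = (z, w) := fun w ↦ by
      by_cases hw : w ∈ Metric.closedBall (0 : E) (R / 2)
      · obtain ⟨Φ, h⟩ := hex (z, w) (by simpa [Prod.dist_eq, hz'] using hw)
        exact ⟨Φ, fun _ ↦ h⟩
      · exact ⟨0, fun h ↦ absurd h hw⟩
    choose Φ hΦ using hex'
    have hsurj := surjOn_closedBall_of_norm_sub_smul_le (f := fun w ↦ (Φ w ε).1) hε
      (r := R / 2) (by positivity) (fun v hv w hw ↦ by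
        have h1 := IsGeodesicOn.norm_fst_sub_le hL hLε hε.le (hΦ v hv).1 (hΦ w hw).1
        rw [(hΦ v hv).2, (hΦ w hw).2] at h1
        simpa [Prod.norm_def] using h1)
    have h00 : (0 : E) ∈ Metric.closedBall (0 : E) (R / 2) :=
      Metric.mem_closedBall_self (by positivity)
    -- the geodesic with initial velocity `0` is constant
    have hconst : D.IsGeodesicOn K ε (fun _ ↦ (z, 0)) := fun s hs ↦ by
      refine ⟨?_, ?_⟩
      · rw [spray_zero]; exact hasDerivWithinAt_const _ _ _
      · simp only [hKdef, Metric.mem_closedBall, Prod.dist_eq, dist_self]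
        exact max_le (by linarith) hR.le
    have hc : (Φ 0 ε).1 = z := by
      have h1 := IsGeodesicOn.norm_sub_le hL hLε (hΦ 0 h00).1 hconst (s := ε) ⟨hε.le, le_rfl⟩
      rw [(hΦ 0 h00).2, sub_self, norm_zero, mul_zero, norm_le_zero_iff, sub_eq_zero] at h1
      rw [h1]
    obtain ⟨w, hw, hwy⟩ := hsurj (show y ∈ Metric.closedBall _ _ by
      simp only [hc, Metric.mem_closedBall]
      rw [Metric.mem_ball] at hy hz
      have := dist_triangle_right y z x₀
      nlinarith)
    exact ⟨Φ w, (hΦ w hw).1, by rw [(hΦ w hw).2], hwy⟩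

end CoordMetric

/-! ### Causal character and first variation of geodesics -/

/-- A continuous function without zeros keeps its sign. -/
theorem neg_of_continuousOn_of_ne_zero {f : ℝ → ℝ} {a b : ℝ} (hf : ContinuousOn f (Icc a b))
    (h0 : ∀ s ∈ Icc a b, f s ≠ 0) (ha : f a < 0) : ∀ s ∈ Icc a b, f s < 0 := by
  intro s hs
  by_contra! h
  obtain ⟨u, hu, hu0⟩ := intermediate_value_Icc hs.1 (hf.mono (Icc_subset_Icc_right hs.2))
    ⟨ha.le, h⟩
  exact h0 u ⟨hu.1, hu.2.trans hs.2⟩ hu0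

/-- A remainder that is quadratic in the increment of a differentiable curve has derivative `0`. -/
theorem hasDerivAt_zero_of_abs_le_sq {F : Type*} [NormedAddCommGroup F] [NormedSpace ℝ F]
    {γ : ℝ → F} {v : F} {s C : ℝ} {r : ℝ → ℝ} (hγ : HasDerivAt γ v s)
    (hr : ∀ᶠ u in 𝓝 s, |r u| ≤ C * ‖γ u - γ s‖ ^ 2) (hs : r s = 0) : HasDerivAt r 0 s := by
  rw [hasDerivAt_iff_isLittleO]
  simp only [hs, sub_zero, smul_zero]
  have h1 : (fun u ↦ γ u - γ s) =O[𝓝 s] fun u ↦ u - s := hγ.isBigO_sub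
  have h2 : (fun u ↦ ‖γ u - γ s‖ ^ 2) =O[𝓝 s] fun u ↦ (u - s) ^ 2 := h1.norm_left.pow 2
  have h3 : r =O[𝓝 s] fun u ↦ ‖γ u - γ s‖ ^ 2 := by
    refine Asymptotics.IsBigO.of_bound C (hr.mono fun u hu ↦ ?_)
    rwa [Real.norm_eq_abs, Real.norm_of_nonneg (by positivity)]
  refine (h3.trans h2).trans_isLittleO ?_
  have h4 : Tendsto (fun u : ℝ ↦ u - s) (𝓝 s) (𝓝 0) := by
    have : Tendsto (fun u : ℝ ↦ u - s) (𝓝 s) (𝓝 (s - s)) := tendsto_id.sub_const s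
    simpa using this
  exact (Asymptotics.isLittleO_pow_id (one_lt_two)).comp_tendsto h4

namespace CoordMetric

variable {E : Type*} [NormedAddCommGroup E] [NormedSpace ℝ E] {D : CoordMetric E} {x₀ : E}

namespace GeodesicBox

/-- The geodesics, with their velocities, that belong to a geodesic box. -/
def IsGeodesic (B : D.GeodesicBox x₀) (Φ : ℝ → E × E) : Prop :=
  D.IsGeodesicOn (Metric.closedBall (x₀, 0) B.R) B.ε Φ

variable {B : D.GeodesicBox x₀} {Φ Ψ : ℝ → E × E} {s : ℝ}

theorem zero_mem (B : D.GeodesicBox x₀) : (0 : ℝ) ∈ Icc 0 B.ε := ⟨le_rfl, B.ε_pos.le⟩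

theorem ε_mem (B : D.GeodesicBox x₀) : B.ε ∈ Icc 0 B.ε := ⟨B.ε_pos.le, le_rfl⟩

theorem fst_mem {p : E × E} (hp : p ∈ Metric.closedBall (x₀, 0) B.R) : p.1 ∈ D.Ω :=
  B.subset (by
    rw [Metric.mem_closedBall, Prod.dist_eq] at hp
    exact (le_max_left _ _).trans hp)

theorem mem_Ω {z : E} (hz : z ∈ Metric.ball x₀ B.ρ) : z ∈ D.Ω :=
  B.subset (Metric.mem_closedBall.2
    ((Metric.mem_ball.1 hz).le.trans (B.ρ_le.trans B.r_le)))

theorem isGeodesic_const {z : E} (hz : dist z x₀ ≤ B.R) :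
    B.IsGeodesic (fun _ ↦ (z, 0)) := fun s _ ↦ by
  refine ⟨?_, ?_⟩
  · rw [spray_zero]; exact hasDerivWithinAt_const _ _ _
  · simpa [Prod.dist_eq, B.r_pos.le.trans B.r_le] using hz

theorem mk_mem_closedBall_r {z w : E} (hz : z ∈ Metric.ball x₀ B.ρ) (hw : ‖w‖ ≤ B.r) :
    (z, w) ∈ Metric.closedBall ((x₀, 0) : E × E) B.r := by
  have := (Metric.mem_ball.1 hz).le.trans B.ρ_le
  simpa [Prod.dist_eq, this] using hw

theorem IsGeodesic.fst_mem (h : B.IsGeodesic Φ) (hs : s ∈ Icc 0 B.ε) : (Φ s).1 ∈ D.Ω :=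
  GeodesicBox.fst_mem (h s hs).2

theorem IsGeodesic.hasDerivWithinAt_fst (h : B.IsGeodesic Φ) (hs : s ∈ Icc 0 B.ε) :
    HasDerivWithinAt (fun s ↦ (Φ s).1) (Φ s).2 (Icc 0 B.ε) s := by
  simpa [spray] using! (ContinuousLinearMap.fst ℝ E E).hasFDerivAt.comp_hasDerivWithinAt s
    (h s hs).1

theorem IsGeodesic.hasDerivWithinAt_snd (h : B.IsGeodesic Φ) (hs : s ∈ Icc 0 B.ε) :
    HasDerivWithinAt (fun s ↦ (Φ s).2) (D.accel (Φ s).1 (Φ s).2) (Icc 0 B.ε) s := by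
  simpa [spray] using! (ContinuousLinearMap.snd ℝ E E).hasFDerivAt.comp_hasDerivWithinAt s
    (h s hs).1

theorem IsGeodesic.continuousOn (h : B.IsGeodesic Φ) : ContinuousOn Φ (Icc 0 B.ε) :=
  IsGeodesicOn.continuousOn h

/-- Reversing the parametrization of a geodesic. -/
theorem IsGeodesic.reverse (h : B.IsGeodesic Φ) :
    B.IsGeodesic (fun s ↦ ((Φ (B.ε - s)).1, -(Φ (B.ε - s)).2)) := fun s hs ↦ by
  have hs' : B.ε - s ∈ Icc 0 B.ε := ⟨by linarith [hs.2], by linarith [hs.1]⟩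
  have hmaps : MapsTo (fun s ↦ B.ε - s) (Icc 0 B.ε) (Icc 0 B.ε) := fun u hu ↦
    ⟨by linarith [hu.2], by linarith [hu.1]⟩
  have hd : HasDerivWithinAt (fun s ↦ B.ε - s) (-1 : ℝ) (Icc 0 B.ε) s := by
    simpa using (hasDerivWithinAt_id s (Icc 0 B.ε)).const_sub B.ε
  have h1 := (h.hasDerivWithinAt_fst hs').scomp s hd hmaps
  have h2 := ((h.hasDerivWithinAt_snd hs').scomp s hd hmaps).neg
  refine ⟨?_, ?_⟩
  · convert! h1.prodMk h2 using 1
    simp [spray, accel_neg]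
  · have := (h _ hs').2
    simpa [Prod.dist_eq] using this

theorem IsGeodesic.hasDerivWithinAt_Ici (h : B.IsGeodesic Φ) (hs : s ∈ Ico 0 B.ε) :
    HasDerivWithinAt Φ (D.spray (Φ s)) (Ici s) s :=
  IsGeodesicOn.hasDerivWithinAt_Ici h hs

theorem IsGeodesic.lagr_eq [FiniteDimensional ℝ E] (h : B.IsGeodesic Φ) (hs : s ∈ Icc 0 B.ε) :
    D.lagr (Φ s) = D.lagr (Φ 0) := by
  refine constant_of_has_deriv_right_zero (f := fun s ↦ D.lagr (Φ s)) (fun u hu ↦ ?_)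
    (fun u hu ↦ ?_) s hs
  · exact (hasFDerivAt_lagr (h.fst_mem hu)).continuousAt.comp_continuousWithinAt
      (h.continuousOn u hu)
  · have := (hasFDerivAt_lagr (h.fst_mem (Ico_subset_Icc_self hu))).comp_hasDerivWithinAt u
      (h.hasDerivWithinAt_Ici hu)
    rwa [fderiv_lagr_spray (h.fst_mem (Ico_subset_Icc_self hu))] at this

/-- A geodesic whose velocity vanishes somewhere is constant. -/
theorem IsGeodesic.snd_eq_zero (h : B.IsGeodesic Φ) {u : ℝ} (hu : u ∈ Icc 0 B.ε)
    (h0 : (Φ u).2 = 0) (hs : s ∈ Icc 0 B.ε) : Φ s = Φ 0 ∧ (Φ s).2 = 0 := by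
  obtain ⟨L, hL⟩ := B.lipschitz
  have hΦu : Φ u = ((Φ u).1, 0) := Prod.ext rfl h0
  have hc : B.IsGeodesic (fun _ ↦ ((Φ u).1, 0)) := isGeodesic_const (by
    have := (h u hu).2
    rw [Metric.mem_closedBall, Prod.dist_eq] at this
    exact (le_max_left _ _).trans this)
  have hsub : Ioc 0 u ⊆ Icc 0 B.ε := fun t ht ↦ ⟨ht.1.le, ht.2.trans hu.2⟩
  have hderiv : ∀ {Ψ}, B.IsGeodesic Ψ → ∀ t ∈ Ioc 0 u,
      HasDerivWithinAt Ψ (D.spray (Ψ t)) (Iic t) t := fun hΨ t ht ↦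
    (hΨ t (hsub ht)).1.mono_of_mem_nhdsWithin
      (mem_of_superset (Icc_mem_nhdsLE ht.1) (Icc_subset_Icc_right (ht.2.trans hu.2)))
  have heq := ODE_solution_unique_of_mem_Icc_left (v := fun _ ↦ D.spray) (K := L)
    (s := fun _ ↦ Metric.closedBall ((x₀, 0) : E × E) B.R) (a := 0) (b := u)
    (fun _ _ ↦ hL) (h.continuousOn.mono (Icc_subset_Icc_right hu.2)) (hderiv h)
    (fun t ht ↦ (h t (hsub ht)).2) (hc.continuousOn.mono (Icc_subset_Icc_right hu.2)) (hderiv hc)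
    (fun t ht ↦ (hc t (hsub ht)).2) hΦu
  have h00 : Φ 0 = ((Φ u).1, 0) := heq ⟨le_rfl, hu.1⟩
  have h1 := B.norm_sub_le_initial _ _ h hc s hs
  rw [h00, sub_self, norm_zero, mul_zero, norm_le_zero_iff, sub_eq_zero] at h1
  exact ⟨h1.trans h00.symm, by rw [h1]⟩

theorem IsGeodesic.continuousOn_dτ (h : B.IsGeodesic Φ) :
    ContinuousOn (fun s ↦ fderiv ℝ D.τ (Φ s).1 (Φ s).2) (Icc 0 B.ε) := by
  have h1 : ContinuousOn (fun s ↦ (Φ s).1) (Icc 0 B.ε) :=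
    continuous_fst.comp_continuousOn h.continuousOn
  exact (continuousOn_fderiv_τ.comp h1 fun s hs ↦ h.fst_mem hs).clm_apply
    (continuous_snd.comp_continuousOn h.continuousOn)

theorem g_eq_lagr (p : E × E) : D.g p.1 p.2 p.2 = 2 * D.lagr p := by simp [lagr]

/-- The causal character of the velocity does not change along a geodesic. -/
theorem IsGeodesic.dτ_ne_zero [FiniteDimensional ℝ E] (h : B.IsGeodesic Φ) (hl : D.lagr (Φ 0) ≤ 0)
    (h0 : (Φ 0).2 ≠ 0) (hs : s ∈ Icc 0 B.ε) : fderiv ℝ D.τ (Φ s).1 (Φ s).2 ≠ 0 := by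
  refine CoordMetric.dτ_ne_zero (h.fst_mem hs) ?_ fun hz ↦ h0 (h.snd_eq_zero hs hz B.zero_mem).2
  rw [g_eq_lagr, h.lagr_eq hs]
  linarith

theorem IsGeodesic.dτ_neg [FiniteDimensional ℝ E] (h : B.IsGeodesic Φ) (hl : D.lagr (Φ 0) ≤ 0)
    (h0 : fderiv ℝ D.τ (Φ 0).1 (Φ 0).2 < 0) (hs : s ∈ Icc 0 B.ε) :
    fderiv ℝ D.τ (Φ s).1 (Φ s).2 < 0 :=
  neg_of_continuousOn_of_ne_zero h.continuousOn_dτ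
    (fun _ hu ↦ h.dτ_ne_zero hl (fun hz ↦ by simp [hz] at h0) hu) h0 s hs

variable (B) in
/-- The past causal cone bundle over the ball of a geodesic box. -/
def causal : Set (E × E) :=
  {p ∈ Metric.closedBall (x₀, 0) B.R | D.lagr p ≤ 0 ∧ fderiv ℝ D.τ p.1 p.2 ≤ 0}

theorem isClosed_causal : IsClosed B.causal := by
  have hsub : ∀ p ∈ Metric.closedBall ((x₀, 0) : E × E) B.R, p ∈ D.Ω ×ˢ (univ : Set E) :=
    fun p hp ↦ ⟨GeodesicBox.fst_mem hp, trivial⟩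
  have h1 : ContinuousOn D.lagr (Metric.closedBall ((x₀, 0) : E × E) B.R) :=
    contDiffOn_lagr.continuousOn.mono hsub
  have h2 : ContinuousOn (fun p : E × E ↦ fderiv ℝ D.τ p.1 p.2)
      (Metric.closedBall ((x₀, 0) : E × E) B.R) :=
    (continuousOn_fderiv_τ.comp continuousOn_fst fun p hp ↦ (hsub p hp).1).clm_apply
      continuousOn_snd
  have := (h1.prodMk h2).preimage_isClosed_of_isClosed Metric.isClosed_closedBall
    (isClosed_Iic.prod isClosed_Iic : IsClosed (Iic (0 : ℝ) ×ˢ Iic (0 : ℝ)))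
  exact this

theorem IsGeodesic.dτ_neg_of_mem_causal [FiniteDimensional ℝ E] (h : B.IsGeodesic Φ)
    (hc : Φ 0 ∈ B.causal) (h0 : (Φ 0).2 ≠ 0) (hs : s ∈ Icc 0 B.ε) :
    fderiv ℝ D.τ (Φ s).1 (Φ s).2 < 0 :=
  h.dτ_neg hc.2.1 (lt_of_le_of_ne hc.2.2 (h.dτ_ne_zero hc.2.1 h0 B.zero_mem)) hs

theorem IsGeodesic.mem_cone [FiniteDimensional ℝ E] (h : B.IsGeodesic Φ)
    (hc : Φ 0 ∈ B.causal) (hs : s ∈ Icc 0 B.ε) : (Φ s).2 ∈ D.cone (Φ s).1 := by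
  by_cases h0 : (Φ 0).2 = 0
  · rw [(h.snd_eq_zero B.zero_mem h0 hs).2]
    simp [cone]
  · refine ⟨?_, (h.dτ_neg_of_mem_causal hc h0 hs).le⟩
    rw [g_eq_lagr, h.lagr_eq hs]
    linarith [hc.2.1]

theorem IsGeodesic.τ_lt [FiniteDimensional ℝ E] (h : B.IsGeodesic Φ)
    (hc : Φ 0 ∈ B.causal) (h0 : (Φ 0).2 ≠ 0) : D.τ (Φ B.ε).1 < D.τ (Φ 0).1 := by
  have hder : ∀ s ∈ Icc 0 B.ε, HasDerivWithinAt (fun s ↦ D.τ (Φ s).1)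
      (fderiv ℝ D.τ (Φ s).1 (Φ s).2) (Icc 0 B.ε) s := fun s hs ↦
    (hasFDerivAt_τ (h.fst_mem hs)).comp_hasDerivWithinAt s (h.hasDerivWithinAt_fst hs)
  refine strictAntiOn_of_deriv_neg (convex_Icc 0 B.ε)
    (fun s hs ↦ (hder s hs).continuousWithinAt) (fun s hs ↦ ?_) B.zero_mem B.ε_mem B.ε_pos
  rw [interior_Icc] at hs
  rw [((hder s (Ioo_subset_Icc_self hs)).hasDerivAt (Icc_mem_nhds hs.1 hs.2)).deriv]
  exact h.dτ_neg_of_mem_causal hc h0 (Ioo_subset_Icc_self hs)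

/-- The first variation formula for the energy of geodesics with a common initial point. -/
theorem IsGeodesic.first_variation [FiniteDimensional ℝ E] (hΦ : B.IsGeodesic Φ)
    (hΨ : B.IsGeodesic Ψ) (h0 : (Φ 0).1 = (Ψ 0).1) :
    |D.g (Φ B.ε).1 (Φ B.ε).2 ((Ψ B.ε).1 - (Φ B.ε).1) - B.ε * (D.lagr (Ψ 0) - D.lagr (Φ 0))|
      ≤ B.ε * B.Λ ^ 3 * ‖(Ψ B.ε).1 - (Φ B.ε).1‖ ^ 2 := by
  set h := D.lagr (Ψ 0) - D.lagr (Φ 0)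
  have hder : ∀ s ∈ Icc 0 B.ε, HasDerivWithinAt
      (fun s ↦ D.g (Φ s).1 (Φ s).2 ((Ψ s).1 - (Φ s).1) - s * h)
      (fderiv ℝ D.lagr (Φ s) (Ψ s - Φ s) - h) (Icc 0 B.ε) s := fun s hs ↦ by
    have hx := hΦ.fst_mem hs
    have h1 := HasFDerivAt.comp_hasDerivWithinAt s (hasFDerivAt_g hx) (hΦ.hasDerivWithinAt_fst hs)
    have h2 := (h1.clm_apply (hΦ.hasDerivWithinAt_snd hs)).clm_apply
      ((hΨ.hasDerivWithinAt_fst hs).sub (hΦ.hasDerivWithinAt_fst hs))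
    have h3 := h2.sub ((hasDerivWithinAt_id s (Icc 0 B.ε)).mul_const h)
    convert! h3 using 1
    rw [fderiv_lagr hx]
    simp only [add_apply, Function.comp_apply, g_accel hx, Prod.fst_sub, Prod.snd_sub, Pi.sub_apply]
    ring
  have hbd : ∀ s ∈ Icc 0 B.ε, ‖fderiv ℝ D.lagr (Φ s) (Ψ s - Φ s) - h‖
      ≤ B.Λ ^ 3 * ‖(Ψ B.ε).1 - (Φ B.ε).1‖ ^ 2 := fun s hs ↦ by
    have h1 := B.taylor _ (hΦ s hs).2 _ (hΨ s hs).2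
    rw [hΦ.lagr_eq hs, hΨ.lagr_eq hs, abs_sub_comm] at h1
    have h2 := B.norm_sub_le_ends _ _ hΨ hΦ s hs
    rw [h0, sub_self, norm_zero, add_zero] at h2
    rw [Real.norm_eq_abs]
    have := B.Λ_pos
    calc _ ≤ B.Λ * ‖Ψ s - Φ s‖ ^ 2 := h1
      _ ≤ B.Λ * (B.Λ * ‖(Ψ B.ε).1 - (Φ B.ε).1‖) ^ 2 := by gcongr
      _ = _ := by ring
  have h3 := norm_image_sub_le_of_norm_deriv_le_segment' hder
    (fun x hx ↦ hbd x (Ico_subset_Icc_self hx)) B.ε B.ε_mem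
  rw [h0, sub_self, map_zero, zero_mul, sub_zero, sub_zero, sub_zero, Real.norm_eq_abs] at h3
  calc _ ≤ _ := h3
    _ = _ := by ring

end GeodesicBox

end CoordMetric

/-! ### The causal relation in a geodesic box -/

namespace CoordMetric

variable {E : Type*} [NormedAddCommGroup E] [NormedSpace ℝ E] {D : CoordMetric E} {x₀ : E}

variable (D) in
/-- The point `y` is reached from `z` by a past-directed causal curve that stays in `W`. -/
def CausallyJoined (W : Set E) (z y : E) : Prop :=
  ∃ (c : ℝ → E) (a b : ℝ), a < b ∧ ContinuousOn c (Icc a b) ∧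
    (∀ s ∈ Ioo a b, ∃ v ∈ D.cone (c s), HasDerivAt c v s) ∧ MapsTo c (Icc a b) W ∧ c a = z ∧ c b = y

namespace GeodesicBox

variable {B : D.GeodesicBox x₀}

/-- The squared length of the geodesics from a fixed base point decreases along causal curves
once it is negative: by the first variation formula its derivative is the product of the velocity of
the geodesic and the velocity of the curve. -/
theorem lagr_neg_of_causal [FiniteDimensional ℝ E] {Ξ Φ : ℝ → E × E} (hΞ : B.IsGeodesic Ξ)
    (hΦ : B.IsGeodesic Φ) (hbase : (Ξ 0).1 ∈ Metric.ball x₀ B.ρ) (hΦ0 : (Φ 0).1 = (Ξ 0).1)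
    (hl : D.lagr (Ξ 0) < 0) (hτ : fderiv ℝ D.τ (Ξ 0).1 (Ξ 0).2 < 0)
    (hj : D.CausallyJoined (Metric.ball x₀ B.ρ) (Ξ B.ε).1 (Φ B.ε).1) :
    D.lagr (Φ 0) < 0 ∧ fderiv ℝ D.τ (Φ 0).1 (Φ 0).2 < 0 := by
  obtain ⟨c, a, b, hab, hcont, hder, hmaps, hca, hcb⟩ := hj
  have hΛ := B.Λ_pos
  have hε := B.ε_pos
  set z := (Ξ 0).1 with hz
  -- the geodesics from the base point to the points of the curve
  have hex : ∀ s, ∃ Ψ, s ∈ Icc a b → B.IsGeodesic Ψ ∧ (Ψ 0).1 = z ∧ (Ψ B.ε).1 = c s := fun s ↦ by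
    by_cases hs : s ∈ Icc a b
    · obtain ⟨Ψ, h⟩ := B.joined z hbase (c s) (hmaps hs)
      exact ⟨Ψ, fun _ ↦ h⟩
    · exact ⟨0, fun h ↦ absurd h hs⟩
  choose Ψ hΨ using hex
  have huniq : ∀ {Θ : ℝ → E × E} {s}, B.IsGeodesic Θ → (Θ 0).1 = z → s ∈ Icc a b →
      (Θ B.ε).1 = c s → Ψ s 0 = Θ 0 := fun {Θ s} hΘ h0 hs h1 ↦ by
    have := B.norm_sub_le_ends _ _ (hΨ s hs).1 hΘ 0 B.zero_mem
    rwa [(hΨ s hs).2.1, (hΨ s hs).2.2, h0, h1, sub_self, sub_self, norm_zero, add_zero, mul_zero,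
      norm_le_zero_iff, sub_eq_zero] at this
  have ha : a ∈ Icc a b := ⟨le_rfl, hab.le⟩
  have hb : b ∈ Icc a b := ⟨hab.le, le_rfl⟩
  have hΨa : Ψ a 0 = Ξ 0 := huniq hΞ rfl ha hca.symm
  have hΨb : Ψ b 0 = Φ 0 := huniq hΦ hΦ0 hb hcb.symm
  have hΨcont : ContinuousOn (fun s ↦ Ψ s 0) (Icc a b) := fun s hs ↦ by
    rw [ContinuousWithinAt, tendsto_iff_norm_sub_tendsto_zero]
    have h1 : Tendsto (fun u ↦ B.Λ * ‖c u - c s‖) (𝓝[Icc a b] s) (𝓝 0) := by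
      simpa using (tendsto_iff_norm_sub_tendsto_zero.1 (hcont s hs)).const_mul B.Λ
    refine squeeze_zero' (Eventually.of_forall fun _ ↦ norm_nonneg _) ?_ h1
    filter_upwards [self_mem_nhdsWithin] with u hu
    have := B.norm_sub_le_ends _ _ (hΨ u hu).1 (hΨ s hs).1 0 B.zero_mem
    rwa [(hΨ s hs).2.1, (hΨ s hs).2.2, (hΨ u hu).2.1, (hΨ u hu).2.2, sub_self, norm_zero,
      add_zero] at this
  have hmem : ∀ s ∈ Icc a b, Ψ s 0 ∈ Metric.closedBall ((x₀, 0) : E × E) B.R := fun s hs ↦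
    ((hΨ s hs).1 0 B.zero_mem).2
  have hfcont : ContinuousOn (fun s ↦ D.lagr (Ψ s 0)) (Icc a b) :=
    contDiffOn_lagr.continuousOn.comp hΨcont fun s hs ↦ ⟨fst_mem (hmem s hs), trivial⟩
  have hτcont : ContinuousOn (fun s ↦ fderiv ℝ D.τ (Ψ s 0).1 (Ψ s 0).2) (Icc a b) :=
    (continuousOn_fderiv_τ.comp (continuous_fst.comp_continuousOn hΨcont)
      fun s hs ↦ fst_mem (hmem s hs)).clm_apply (continuous_snd.comp_continuousOn hΨcont)
  have hsign : ∀ u ∈ Icc a b, (∀ s ∈ Icc a u, D.lagr (Ψ s 0) < 0) →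
      ∀ s ∈ Icc a u, fderiv ℝ D.τ (Ψ s 0).1 (Ψ s 0).2 < 0 := fun u hu hneg ↦ by
    have hsub : Icc a u ⊆ Icc a b := Icc_subset_Icc_right hu.2
    refine neg_of_continuousOn_of_ne_zero (hτcont.mono hsub) (fun s hs ↦ ?_) (by rwa [hΨa])
    refine (hΨ s (hsub hs)).1.dτ_ne_zero (hneg s hs).le (fun h0 ↦ ?_) B.zero_mem
    have := hneg s hs
    simp [lagr, h0] at this
  have hderiv : ∀ s ∈ Ioo a b, ∃ v ∈ D.cone (c s), HasDerivAt (fun s ↦ D.lagr (Ψ s 0))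
      (B.ε⁻¹ * D.g (c s) (Ψ s B.ε).2 v) s := fun s hs ↦ by
    obtain ⟨v, hv, hcv⟩ := hder s hs
    have hs' := Ioo_subset_Icc_self hs
    refine ⟨v, hv, ?_⟩
    have hlin : HasDerivAt (fun u ↦ D.g (c s) (Ψ s B.ε).2 (c u - c s))
        (D.g (c s) (Ψ s B.ε).2 v) s :=
      (D.g (c s) (Ψ s B.ε).2).hasFDerivAt.comp_hasDerivAt s (hcv.sub_const (c s))
    have hrem : HasDerivAt (fun u ↦ D.g (c s) (Ψ s B.ε).2 (c u - c s)
        - B.ε * (D.lagr (Ψ u 0) - D.lagr (Ψ s 0))) 0 s := by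
      refine hasDerivAt_zero_of_abs_le_sq hcv (C := B.ε * B.Λ ^ 3) ?_ (by simp)
      filter_upwards [Icc_mem_nhds hs.1 hs.2] with u hu
      have := (hΨ s hs').1.first_variation (hΨ u hu).1
        ((hΨ s hs').2.1.trans (hΨ u hu).2.1.symm)
      rwa [(hΨ s hs').2.2, (hΨ u hu).2.2] at this
    have h1 := ((hlin.sub hrem).const_mul B.ε⁻¹).add_const (D.lagr (Ψ s 0))
    rw [sub_zero] at h1
    refine h1.congr_of_eventuallyEq (Eventually.of_forall fun u ↦ ?_)
    simp only [Pi.sub_apply]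
    field_simp
    ring
  have hall : ∀ s ∈ Icc a b, D.lagr (Ψ s 0) < 0 := by
    by_contra! hcon
    obtain ⟨s₁, hs₁, hpos⟩ := hcon
    -- the first parameter at which the squared length fails to be negative
    have hclosed : IsCompact {s ∈ Icc a b | D.lagr (Ψ s 0) ∈ Ici (0 : ℝ)} :=
      isCompact_Icc.of_isClosed_subset
        (hfcont.preimage_isClosed_of_isClosed isClosed_Icc isClosed_Ici) inter_subset_left
    obtain ⟨u, ⟨hu, hu0⟩, hleast⟩ := hclosed.exists_isLeast ⟨s₁, hs₁, hpos⟩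
    have hneg : ∀ s ∈ Ico a u, D.lagr (Ψ s 0) < 0 := fun s hs ↦ by
      by_contra! h
      exact absurd (hleast ⟨⟨hs.1, hs.2.le.trans hu.2⟩, h⟩) (not_le.2 hs.2)
    have hanti : AntitoneOn (fun s ↦ D.lagr (Ψ s 0)) (Icc a u) := by
      refine antitoneOn_of_deriv_nonpos (convex_Icc a u) (hfcont.mono (Icc_subset_Icc_right hu.2))
        (fun s hs ↦ ?_) (fun s hs ↦ ?_) <;> rw [interior_Icc] at hs <;>
        obtain ⟨v, hv, hd⟩ := hderiv s ⟨hs.1, hs.2.trans_le hu.2⟩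
      · exact hd.differentiableAt.differentiableWithinAt
      · rw [hd.deriv]
        have hs' : s ∈ Icc a b := ⟨hs.1.le, hs.2.le.trans hu.2⟩
        have hΨs := (hΨ s hs').1
        have hls := hneg s ⟨hs.1.le, hs.2⟩
        have hτs := hsign s hs' (fun t ht ↦ hneg t ⟨ht.1, ht.2.trans_lt hs.2⟩) s ⟨hs.1.le, le_rfl⟩
        have hP1 := hΨs.dτ_neg hls.le hτs B.ε_mem
        have hP2 : D.g (Ψ s B.ε).1 (Ψ s B.ε).2 (Ψ s B.ε).2 < 0 := by
          rw [g_eq_lagr, hΨs.lagr_eq B.ε_mem]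
          linarith
        rw [(hΨ s hs').2.2] at hP1 hP2
        exact mul_nonpos_of_nonneg_of_nonpos (by positivity)
          (nonpos_of_mem_cone (mem_Ω (hmaps hs')) hP2 hP1 hv)
    have h1 : D.lagr (Ψ u 0) ≤ D.lagr (Ψ a 0) := hanti ⟨le_rfl, hu.1⟩ ⟨hu.1, le_rfl⟩ hu.1
    rw [hΨa] at h1
    exact absurd (hu0 : (0 : ℝ) ≤ _) (not_le.2 (h1.trans_lt hl))
  have h1 := hall b hb
  have h2 := hsign b hb hall b hb
  rw [hΨb] at h1 h2
  exact ⟨h1, h2⟩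

/-- Every point of a geodesic box lies on timelike geodesics that come from points in its future,
arbitrarily close to it. -/
theorem exists_timelike_geodesic_to [FiniteDimensional ℝ E] (B : D.GeodesicBox x₀) {z : E}
    (hz : z ∈ Metric.ball x₀ B.ρ) {δ : ℝ} (hδ : 0 < δ) :
    ∃ Ξ, B.IsGeodesic Ξ ∧ (Ξ B.ε).1 = z ∧ (Ξ 0).1 ∈ Metric.ball x₀ B.ρ ∧ ‖(Ξ 0).1 - z‖ < δ ∧
      D.lagr (Ξ 0) < 0 ∧ fderiv ℝ D.τ (Ξ 0).1 (Ξ 0).2 < 0 := by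
  obtain ⟨N, hN, hNN⟩ := D.grad z (mem_Ω hz)
  have hΛ := B.Λ_pos
  have hr := B.r_pos
  have hgap : 0 < B.ρ - dist z x₀ := sub_pos.2 hz
  obtain ⟨η, hη, hηN⟩ : ∃ η : ℝ, 0 < η ∧
      η * ‖N‖ < min B.r (min (B.ρ - dist z x₀) δ / B.Λ) := by
    have hpos : 0 < min B.r (min (B.ρ - dist z x₀) δ / B.Λ) := by positivity
    obtain ⟨η, hη, h⟩ := exists_pos_mul_lt hpos ‖N‖
    exact ⟨η, hη, by rwa [mul_comm]⟩
  have hnorm : ‖(-η) • N‖ = η * ‖N‖ := by rw [norm_smul, norm_neg, Real.norm_of_nonneg hη.le]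
  obtain ⟨Θ, hΘ : B.IsGeodesic Θ, hΘ0⟩ := B.exists_geodesic (z, (-η) • N)
    (mk_mem_closedBall_r hz (by rw [hnorm]; exact (hηN.trans_le (min_le_left _ _)).le))
  have hclose : ‖(Θ B.ε).1 - z‖ < min (B.ρ - dist z x₀) δ := by
    have hconst : B.IsGeodesic (fun _ ↦ (z, 0)) := isGeodesic_const
      ((Metric.mem_ball.1 hz).le.trans (B.ρ_le.trans B.r_le))
    have h1 := B.norm_sub_le_initial _ _ hΘ hconst B.ε B.ε_mem
    have h2 : ‖(Θ B.ε).1 - z‖ ≤ ‖Θ B.ε - (z, 0)‖ := norm_fst_le (Θ B.ε - (z, 0))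
    have h3 : ‖Θ 0 - (z, 0)‖ = η * ‖N‖ := by
      rw [hΘ0, ← hnorm, Prod.norm_def]
      simp
    rw [h3] at h1
    have h4 := (lt_div_iff₀ hΛ).1 (hηN.trans_le (min_le_right _ _))
    linarith
  have hl : D.lagr (Θ 0) < 0 := by
    rw [hΘ0]
    simp only [lagr, map_smul, smul_apply, smul_eq_mul]
    have : 0 < η * η := by positivity
    nlinarith
  have hτ : ∀ s ∈ Icc 0 B.ε, -fderiv ℝ D.τ (Θ s).1 (Θ s).2 < 0 := by
    refine neg_of_continuousOn_of_ne_zero hΘ.continuousOn_dτ.neg (fun s hs ↦ ?_) ?_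
    · refine neg_ne_zero.2 (hΘ.dτ_ne_zero hl.le (fun h0 ↦ ?_) hs)
      simp [lagr, h0] at hl
    · rw [hΘ0]
      simp only [map_smul, smul_eq_mul, ← hN]
      nlinarith
  refine ⟨_, hΘ.reverse, by simp [hΘ0], ?_, ?_, ?_, ?_⟩
  · have h1 := hclose.trans_le (min_le_left _ _)
    rw [← dist_eq_norm] at h1
    simp only [sub_zero, Metric.mem_ball]
    linarith [dist_triangle (Θ B.ε).1 z x₀]
  · simpa using hclose.trans_le (min_le_right _ _)
  · have := hΘ.lagr_eq B.ε_mem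
    simp only [sub_zero, lagr, map_neg, neg_apply, neg_neg] at this ⊢
    rw [this]
    exact hl
  · simpa using hτ B.ε B.ε_mem

/-- Points of a geodesic box that are joined by a causal curve are joined by a causal geodesic. -/
theorem mem_causal_of_causallyJoined [FiniteDimensional ℝ E] {Φ : ℝ → E × E}
    (hΦ : B.IsGeodesic Φ) (hz : (Φ 0).1 ∈ Metric.ball x₀ B.ρ) (hy : (Φ B.ε).1 ∈ Metric.ball x₀ B.ρ)
    (hj : D.CausallyJoined (Metric.ball x₀ B.ρ) (Φ 0).1 (Φ B.ε).1) : Φ 0 ∈ B.causal := by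
  rw [← isClosed_causal.closure_eq, Metric.mem_closure_iff]
  intro δ hδ
  have hΛ := B.Λ_pos
  obtain ⟨Ξ, hΞ, hΞε, hΞ0, hclose, hl, hτ⟩ := B.exists_timelike_geodesic_to hz
    (δ := δ / B.Λ) (by positivity)
  obtain ⟨Ψ, hΨ : B.IsGeodesic Ψ, hΨ0, hΨε⟩ := B.joined _ hΞ0 _ hy
  rw [← hΞε, ← hΨε] at hj
  obtain ⟨h1, h2⟩ := lagr_neg_of_causal hΞ hΨ hΞ0 hΨ0 hl hτ hj
  refine ⟨Ψ 0, ⟨(hΨ 0 B.zero_mem).2, h1.le, h2.le⟩, ?_⟩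
  have h3 := B.norm_sub_le_ends _ _ hΦ hΨ 0 B.zero_mem
  rw [hΨε, sub_self, norm_zero, zero_add, hΨ0, norm_sub_rev (Φ 0).1] at h3
  rw [dist_eq_norm]
  rw [lt_div_iff₀' hΛ] at hclose
  exact h3.trans_lt hclose

/-- The causal relation of a geodesic box is closed, and it is realized by geodesics. -/
theorem exists_geodesic_of_mem_closure [FiniteDimensional ℝ E] {z y : E}
    (hz : z ∈ Metric.ball x₀ B.ρ) (hy : y ∈ Metric.ball x₀ B.ρ)
    (h : (z, y) ∈ closure {q : E × E | D.CausallyJoined (Metric.ball x₀ B.ρ) q.1 q.2}) :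
    ∃ Φ, B.IsGeodesic Φ ∧ (Φ 0).1 = z ∧ (Φ B.ε).1 = y ∧ Φ 0 ∈ B.causal := by
  obtain ⟨Φ, hΦ : B.IsGeodesic Φ, hΦ0, hΦε⟩ := B.joined z hz y hy
  refine ⟨Φ, hΦ, hΦ0, hΦε, ?_⟩
  rw [← isClosed_causal.closure_eq, Metric.mem_closure_iff]
  intro δ hδ
  have hΛ := B.Λ_pos
  obtain ⟨⟨z', y'⟩, hj, hclose⟩ := Metric.mem_closure_iff.1 h (δ / (2 * B.Λ)) (by positivity)
  have hj' := hj
  obtain ⟨c, a, b, hab, -, -, hmaps, hca, hcb⟩ := hj'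
  have hz' : z' ∈ Metric.ball x₀ B.ρ := by simpa [hca] using hmaps ⟨le_rfl, hab.le⟩
  have hy' : y' ∈ Metric.ball x₀ B.ρ := by simpa [hcb] using hmaps ⟨hab.le, le_rfl⟩
  obtain ⟨Ψ, hΨ : B.IsGeodesic Ψ, hΨ0, hΨε⟩ := B.joined z' hz' y' hy'
  refine ⟨Ψ 0, mem_causal_of_causallyJoined hΨ (hΨ0 ▸ hz') (hΨε ▸ hy') ?_, ?_⟩
  · rw [hΨ0, hΨε]; exact hj
  · have h3 := B.norm_sub_le_ends _ _ hΦ hΨ 0 B.zero_mem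
    rw [hΦ0, hΦε, hΨ0, hΨε] at h3
    rw [Prod.dist_eq, max_lt_iff, dist_eq_norm, dist_eq_norm] at hclose
    rw [dist_eq_norm]
    calc _ ≤ _ := h3
      _ < B.Λ * (δ / (2 * B.Λ) + δ / (2 * B.Λ)) := by gcongr; exacts [hclose.2, hclose.1]
      _ = δ := by field_simp; ring

theorem IsGeodesic.contDiffOn_fst [FiniteDimensional ℝ E] {Φ : ℝ → E × E} (h : B.IsGeodesic Φ) :
    ContDiffOn ℝ ∞ (fun s ↦ (Φ s).1) (Icc 0 B.ε) := by
  have h1 : ContDiffOn ℝ ∞ (Function.uncurry fun (_ : ℝ) ↦ D.spray)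
      (Icc 0 B.ε ×ˢ (D.Ω ×ˢ univ)) := contDiffOn_spray.comp contDiffOn_snd fun p hp ↦ hp.2
  have h2 : ContDiffOn ℝ ∞ Φ (Icc 0 B.ε) := ODE.contDiffOn_enat_Icc_of_hasDerivWithinAt (n := ⊤) h1
    (fun t ht ↦ (h t ht).1) (fun t ht ↦ ⟨h.fst_mem ht, trivial⟩)
  exact contDiff_fst.comp_contDiffOn h2

end GeodesicBox

/-- Every point of the coordinate domain has a neighbourhood in which the causal relation is closed,
realized by smooth causal curves and strictly monotone for the time function; moreover
the point has other points in its past. -/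
theorem exists_ball_causal_closed [FiniteDimensional ℝ E] (hx₀ : x₀ ∈ D.Ω) :
    ∃ ρ > 0, (∀ z ∈ Metric.ball x₀ ρ, ∀ y ∈ Metric.ball x₀ ρ,
      (z, y) ∈ closure {q : E × E | D.CausallyJoined (Metric.ball x₀ ρ) q.1 q.2} →
      (∃ (c : ℝ → E) (ε : ℝ), 0 < ε ∧ ContDiffOn ℝ ∞ c (Icc 0 ε) ∧ c 0 = z ∧ c ε = y ∧
        ∀ s ∈ Icc 0 ε, c s ∈ D.Ω ∧ derivWithin c (Icc 0 ε) s ∈ D.cone (c s)) ∧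
      (y ≠ z → D.τ y < D.τ z)) ∧
    ∃ (c : ℝ → E) (ε : ℝ), 0 < ε ∧ ContDiffOn ℝ ∞ c (Icc 0 ε) ∧ c 0 = x₀ ∧ D.τ (c ε) < D.τ x₀ ∧
        ∀ s ∈ Icc 0 ε, c s ∈ D.Ω ∧ derivWithin c (Icc 0 ε) s ∈ D.cone (c s) := by
  obtain ⟨B⟩ := exists_geodesicBox hx₀
  have hcurve : ∀ Φ, B.IsGeodesic Φ → Φ 0 ∈ B.causal → ∀ s ∈ Icc 0 B.ε, (Φ s).1 ∈ D.Ω ∧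
      derivWithin (fun s ↦ (Φ s).1) (Icc 0 B.ε) s ∈ D.cone (Φ s).1 := fun Φ h hc s hs ↦ by
    refine ⟨h.fst_mem hs, ?_⟩
    rw [(h.hasDerivWithinAt_fst hs).derivWithin (uniqueDiffOn_Icc B.ε_pos s hs)]
    exact h.mem_cone hc hs
  refine ⟨B.ρ, B.ρ_pos, fun z hz y hy h ↦ ?_, ?_⟩
  · obtain ⟨Φ, hΦ, hΦ0, hΦε, hc⟩ := GeodesicBox.exists_geodesic_of_mem_closure hz hy h
    refine ⟨⟨_, B.ε, B.ε_pos, hΦ.contDiffOn_fst, hΦ0, hΦε, hcurve Φ hΦ hc⟩, fun hne ↦ ?_⟩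
    rw [← hΦ0, ← hΦε]
    refine hΦ.τ_lt hc fun h0 ↦ hne ?_
    rw [← hΦ0, ← hΦε, (hΦ.snd_eq_zero B.zero_mem h0 B.ε_mem).1]
  · obtain ⟨N, hN, hNN⟩ := D.grad x₀ hx₀
    have hx : x₀ ∈ Metric.ball x₀ B.ρ := Metric.mem_ball_self B.ρ_pos
    obtain ⟨η, hη, hηN⟩ := exists_pos_mul_lt B.r_pos ‖N‖
    obtain ⟨Φ, hΦ : B.IsGeodesic Φ, hΦ0⟩ := B.exists_geodesic (x₀, η • N)
      (GeodesicBox.mk_mem_closedBall_r hx (by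
        rw [norm_smul, Real.norm_of_nonneg hη.le, mul_comm]; exact hηN.le))
    have hc : Φ 0 ∈ B.causal := by
      refine ⟨(hΦ 0 B.zero_mem).2, ?_, ?_⟩ <;> rw [hΦ0]
      · simp only [lagr, map_smul, smul_apply, smul_eq_mul]
        have : 0 < η * η := by positivity
        nlinarith
      · simp only [map_smul, smul_eq_mul, ← hN]
        nlinarith
    refine ⟨_, B.ε, B.ε_pos, hΦ.contDiffOn_fst, by rw [hΦ0], ?_, hcurve Φ hΦ hc⟩
    have := hΦ.τ_lt hc (by
      rw [hΦ0]
      refine smul_ne_zero hη.ne' ?_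
      rintro rfl
      simp at hNN)
    rwa [hΦ0] at this

end CoordMetric

/-! ### The metric and the time function in a chart -/

namespace LorentzianMetric

variable {n : ℕ} {M : Type*} [TopologicalSpace M]
  [ChartedSpace (EuclideanSpace ℝ (Fin (n + 1))) M] [IsManifold (𝓡 (n + 1)) ∞ M]
  {g : LorentzianMetric n M}

/-- The orthogonal complement of a timelike vector is spacelike. -/
theorem pos_of_orthogonal {x : M} {u v : TangentSpace (𝓡 (n + 1)) x} (hu : g.val x u u < 0)
    (huv : g.val x u v = 0) (hv : v ≠ 0) : 0 < g.val x v v := by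
  obtain ⟨e, he⟩ := g.signature x
  have hexp : ∀ a b : TangentSpace (𝓡 (n + 1)) x, g.val x a b =
      -(e.repr a 0 * e.repr b 0) + ∑ i : Fin n, e.repr a i.succ * e.repr b i.succ := by
    intro a b
    have h1 : g.val x a b = ∑ i, ∑ j, e.repr a i * (e.repr b j * g.val x (e i) (e j)) := by
      conv_lhs => rw [← e.sum_repr a, ← e.sum_repr b]
      simp only [map_sum, map_smul, sum_apply, smul_apply, smul_eq_mul, Finset.mul_sum]
      rw [Finset.sum_comm]
      exact Finset.sum_congr rfl fun i _ ↦ Finset.sum_congr rfl fun j _ ↦ by ring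
    rw [h1]
    have h2 : ∀ i, ∑ j, e.repr a i * (e.repr b j * g.val x (e i) (e j)) =
        e.repr a i * e.repr b i * (if i = 0 then -1 else 1) := fun i ↦ by
      rw [Finset.sum_eq_single i (fun j _ hj ↦ by simp [he, hj.symm]) (by simp)]
      simp [he]
    simp only [h2, Fin.sum_univ_succ]
    simp [Fin.succ_ne_zero]
  rw [hexp] at hu huv ⊢
  have hcs := Finset.sum_mul_sq_le_sq_mul_sq Finset.univ (fun i : Fin n ↦ e.repr u i.succ)
    (fun i : Fin n ↦ e.repr v i.succ)
  have hss : ∀ w : TangentSpace (𝓡 (n + 1)) x, ∑ i : Fin n, e.repr w i.succ * e.repr w i.succ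
      = ∑ i : Fin n, e.repr w i.succ ^ 2 := fun w ↦ by simp only [sq]
  rw [hss] at hu ⊢
  set A := ∑ i : Fin n, e.repr u i.succ ^ 2
  set C := ∑ i : Fin n, e.repr v i.succ ^ 2 with hC
  have hA0 : 0 ≤ A := Finset.sum_nonneg fun _ _ ↦ sq_nonneg _
  have hC0 : 0 ≤ C := Finset.sum_nonneg fun _ _ ↦ sq_nonneg _
  set u0 := e.repr u 0
  set v0 := e.repr v 0 with hv0
  have hsum : ∑ i : Fin n, e.repr u i.succ * e.repr v i.succ = u0 * v0 := by linarith
  rw [hsum] at hcs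
  have hu0 : A < u0 * u0 := by linarith
  have hu0' : 0 < u0 * u0 := hA0.trans_lt hu0
  by_contra! hcon
  rcases hC0.eq_or_lt with h0 | hpos
  · have h1 : v0 * v0 * (u0 * u0) ≤ 0 := by nlinarith
    have h2 : v0 = 0 := by
      by_contra hne
      have : 0 < v0 * v0 := mul_self_pos.2 hne
      nlinarith
    refine hv (e.forall_coord_eq_zero_iff.1 fun i ↦ ?_)
    refine Fin.cases ?_ (fun j ↦ ?_) i
    · simpa [hv0] using h2
    · have := (Finset.sum_eq_zero_iff_of_nonneg (fun _ _ ↦ sq_nonneg _)).1 (hC.symm.trans h0.symm) j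
        (Finset.mem_univ _)
      simpa using this
  · nlinarith

/-- A timelike and a causal vector on the same side of a timelike vector have negative product. -/
theorem neg_of_same_side {x : M} {X u v : TangentSpace (𝓡 (n + 1)) x} (hX : g.val x X X < 0)
    (hu : g.val x u u < 0) (hXu : 0 < g.val x X u) (hv : g.val x v v ≤ 0) (hXv : 0 < g.val x X v) :
    g.val x u v < 0 := by
  by_contra! h
  have hexp : g.val x (g.val x X v • u - g.val x X u • v) (g.val x X v • u - g.val x X u • v)
      = g.val x X v ^ 2 * g.val x u u - 2 * (g.val x X v * g.val x X u) * g.val x u v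
        + g.val x X u ^ 2 * g.val x v v := by
    simp only [map_sub, map_smul, sub_apply, smul_apply, smul_eq_mul, g.symm x v u]
    ring
  have h1 : g.val x X v ^ 2 * g.val x u u < 0 := mul_neg_of_pos_of_neg (by positivity) hu
  have h2 : 0 ≤ g.val x X v * g.val x X u * g.val x u v := by positivity
  have h3 : g.val x X u ^ 2 * g.val x v v ≤ 0 := mul_nonpos_of_nonneg_of_nonpos (by positivity) hv
  by_cases hw : g.val x X v • u - g.val x X u • v = 0
  · rw [hw] at hexp
    simp only [map_zero] at hexp
    linarith
  · have := pos_of_orthogonal hX (v := g.val x X v • u - g.val x X u • v)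
      (by simp only [map_sub, map_smul, smul_eq_mul]; ring) hw
    linarith

namespace TimeOrientation

variable {O : g.TimeOrientation} {t : M → ℝ}

/-- For a time function `t`, the vectors that are zero or past-pointing are the causal vectors on
which `dt = ⟨grad t, ·⟩` is nonpositive. -/
theorem past_iff (ht : O.IsTimeFunction t) {x : M} {v : TangentSpace (𝓡 (n + 1)) x} :
    (v ≠ 0 → O.IsPastPointing v) ↔
      g.val x v v ≤ 0 ∧ g.val x (g.grad t x) v ≤ 0 := by
  obtain ⟨hT, hF⟩ := ht.2 x
  have hX := O.timelike x
  have hXG : 0 < g.val x (O.field x) (g.grad t x) := by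
    have := hF.2.2
    rw [map_neg] at this
    linarith
  constructor
  · intro h
    by_cases h0 : v = 0
    · simp [h0]
    · obtain ⟨-, h1, h2⟩ := h h0
      exact ⟨not_lt.1 h1, (neg_of_same_side hX hT hXG (not_lt.1 h1) h2).le⟩
  · rintro ⟨h1, h2⟩ h0
    refine ⟨h0, not_lt.2 h1, ?_⟩
    by_contra! hcon
    rcases hcon.lt_or_eq with hlt | heq
    · have := neg_of_same_side hX hT hXG (v := -v) (by simpa using h1) (by simpa using hlt)
      rw [map_neg] at this
      linarith
    · exact absurd (pos_of_orthogonal hX heq h0) (not_lt.2 h1)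

/-- The derivative of the inverse of the chart at `x₀`. -/
noncomputable def chartDeriv (n : ℕ) {M : Type*} [TopologicalSpace M]
    [ChartedSpace (EuclideanSpace ℝ (Fin (n + 1))) M] (x₀ : M)
    (y : EuclideanSpace ℝ (Fin (n + 1))) :
    EuclideanSpace ℝ (Fin (n + 1)) →L[ℝ]
      TangentSpace (𝓡 (n + 1)) ((extChartAt (𝓡 (n + 1)) x₀).symm y) :=
  mfderiv 𝓘(ℝ, EuclideanSpace ℝ (Fin (n + 1))) (𝓡 (n + 1)) (extChartAt (𝓡 (n + 1)) x₀).symm y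

theorem isInvertible_chartDeriv {x₀ : M} {y : EuclideanSpace ℝ (Fin (n + 1))}
    (hy : y ∈ (extChartAt (𝓡 (n + 1)) x₀).target) : (chartDeriv n x₀ y).IsInvertible := by
  have := isInvertible_mfderivWithin_extChartAt_symm (I := 𝓡 (n + 1)) hy
  rwa [ModelWithCorners.range_eq_univ, mfderivWithin_univ] at this

theorem contMDiffOn_chartDeriv (x₀ : M) (a : EuclideanSpace ℝ (Fin (n + 1))) :
    ContMDiffOn 𝓘(ℝ, EuclideanSpace ℝ (Fin (n + 1))) (𝓡 (n + 1)).tangent ∞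
      (fun y ↦ (⟨(extChartAt (𝓡 (n + 1)) x₀).symm y, chartDeriv n x₀ y a⟩ :
        TangentBundle (𝓡 (n + 1)) M)) (extChartAt (𝓡 (n + 1)) x₀).target := by
  have h1 := (contMDiffOn_extChartAt_symm (I := 𝓡 (n + 1)) (n := ∞) x₀).contMDiffOn_tangentMapWithin
    (m := ∞) (by simp) (isOpen_extChartAt_target x₀).uniqueMDiffOn
  have h2 : ContMDiffOn 𝓘(ℝ, EuclideanSpace ℝ (Fin (n + 1)))
      𝓘(ℝ, EuclideanSpace ℝ (Fin (n + 1))).tangent ∞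
      (fun y ↦ (⟨y, a⟩ : TangentBundle 𝓘(ℝ, EuclideanSpace ℝ (Fin (n + 1)))
        (EuclideanSpace ℝ (Fin (n + 1))))) (extChartAt (𝓡 (n + 1)) x₀).target :=
    contMDiffOn_vectorSpace_iff_contDiffOn.2 contDiffOn_const
  refine (h1.comp h2 fun y hy ↦ hy).congr fun y hy ↦ ?_
  simp only [Function.comp_apply, tangentMapWithin, chartDeriv,
    mfderivWithin_of_mem_nhds ((isOpen_extChartAt_target x₀).mem_nhds hy)]
  rfl

/-- The metric read in the chart at `x₀`. -/
noncomputable def chartMetric (g : LorentzianMetric n M) (x₀ : M)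
    (y : EuclideanSpace ℝ (Fin (n + 1))) :
    EuclideanSpace ℝ (Fin (n + 1)) →L[ℝ] EuclideanSpace ℝ (Fin (n + 1)) →L[ℝ] ℝ :=
  ContinuousLinearMap.bilinearComp
    (show EuclideanSpace ℝ (Fin (n + 1)) →L[ℝ] EuclideanSpace ℝ (Fin (n + 1)) →L[ℝ] ℝ from
      g.val ((extChartAt (𝓡 (n + 1)) x₀).symm y))
    (show EuclideanSpace ℝ (Fin (n + 1)) →L[ℝ] EuclideanSpace ℝ (Fin (n + 1)) from
      chartDeriv n x₀ y)
    (show EuclideanSpace ℝ (Fin (n + 1)) →L[ℝ] EuclideanSpace ℝ (Fin (n + 1)) from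
      chartDeriv n x₀ y)

theorem chartMetric_apply (g : LorentzianMetric n M) (x₀ : M)
    (y v w : EuclideanSpace ℝ (Fin (n + 1))) :
    chartMetric g x₀ y v w = g.val ((extChartAt (𝓡 (n + 1)) x₀).symm y)
      (chartDeriv n x₀ y v) (chartDeriv n x₀ y w) := rfl

theorem contDiffOn_chartMetric (g : LorentzianMetric n M) (x₀ : M) :
    ContDiffOn ℝ ∞ (chartMetric g x₀) (extChartAt (𝓡 (n + 1)) x₀).target := by
  rw [contDiffOn_clm_apply]
  intro a
  rw [contDiffOn_clm_apply]
  intro b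
  have h1 := g.contMDiff.comp_contMDiffOn (contMDiffOn_extChartAt_symm (I := 𝓡 (n + 1)) (n := ∞) x₀)
  have h2 := ContMDiffOn.clm_bundle_apply₂ (F₁ := EuclideanSpace ℝ (Fin (n + 1)))
    (F₂ := EuclideanSpace ℝ (Fin (n + 1))) (F₃ := ℝ) (E₃ := Bundle.Trivial M ℝ)
    (E₁ := fun x : M ↦ TangentSpace (𝓡 (n + 1)) x) (E₂ := fun x : M ↦ TangentSpace (𝓡 (n + 1)) x)
    h1 (contMDiffOn_chartDeriv x₀ a) (contMDiffOn_chartDeriv x₀ b)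
  rw [← contMDiffOn_iff_contDiffOn]
  intro y hy
  have h3 := h2 y hy
  rw [Bundle.contMDiffWithinAt_totalSpace] at h3
  exact h3.2

theorem fderiv_comp_chart (g : LorentzianMetric n M) (ht : ContMDiff (𝓡 (n + 1)) 𝓘(ℝ, ℝ) ∞ t)
    {x₀ : M}
    {y : EuclideanSpace ℝ (Fin (n + 1))} (hy : y ∈ (extChartAt (𝓡 (n + 1)) x₀).target)
    (v : EuclideanSpace ℝ (Fin (n + 1))) :
    fderiv ℝ (t ∘ (extChartAt (𝓡 (n + 1)) x₀).symm) y v =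
      g.val ((extChartAt (𝓡 (n + 1)) x₀).symm y) (g.grad t ((extChartAt (𝓡 (n + 1)) x₀).symm y))
        (chartDeriv n x₀ y v) := by
  have h1 : MDifferentiableAt (𝓡 (n + 1)) 𝓘(ℝ, ℝ) t ((extChartAt (𝓡 (n + 1)) x₀).symm y) :=
    (ht _).mdifferentiableAt (by simp)
  have h2 : MDifferentiableAt 𝓘(ℝ, EuclideanSpace ℝ (Fin (n + 1))) (𝓡 (n + 1))
      (extChartAt (𝓡 (n + 1)) x₀).symm y :=
    ((contMDiffOn_extChartAt_symm (I := 𝓡 (n + 1)) (n := ∞) x₀).contMDiffAt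
      ((isOpen_extChartAt_target x₀).mem_nhds hy)).mdifferentiableAt (by simp)
  rw [g.val_grad, ← mfderiv_eq_fderiv, mfderiv_comp y h1 h2]
  rfl

/-- The metric and a time function read in the chart at `x₀`. -/
noncomputable def coordMetric (ht : O.IsTimeFunction t) (x₀ : M) :
    CoordMetric (EuclideanSpace ℝ (Fin (n + 1))) where
  Ω := (extChartAt (𝓡 (n + 1)) x₀).target
  g := chartMetric g x₀
  τ := t ∘ (extChartAt (𝓡 (n + 1)) x₀).symm
  isOpen := isOpen_extChartAt_target x₀
  contDiffOn_g := contDiffOn_chartMetric g x₀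
  contDiffOn_τ := contMDiffOn_iff_contDiffOn.1
    (ht.1.comp_contMDiffOn (contMDiffOn_extChartAt_symm x₀))
  symm y _ v w := by rw [chartMetric_apply, chartMetric_apply, g.symm]
  pos y hy v hv h0 := by
    rw [fderiv_comp_chart g ht.1 hy] at hv
    refine pos_of_orthogonal (ht.2 _).1 hv fun h ↦ h0 ?_
    obtain ⟨A, hA⟩ := isInvertible_chartDeriv hy
    rw [← hA] at h
    exact A.injective ((show A v = 0 from h).trans (map_zero A).symm)
  grad y hy := by
    obtain ⟨A, hA⟩ := isInvertible_chartDeriv hy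
    have hN : chartDeriv n x₀ y (A.symm (g.grad t _)) = g.grad t _ := by
      rw [← hA]; exact A.apply_symm_apply _
    refine ⟨A.symm (g.grad t _), fun w ↦ ?_, ?_⟩
    · rw [fderiv_comp_chart g ht.1 hy]
      rw [chartMetric_apply, hN]
    · have := (ht.2 ((extChartAt (𝓡 (n + 1)) x₀).symm y)).1
      rw [chartMetric_apply, hN]
      exact this

variable (O) in
/-- The vectors at `x` that are zero or past-pointing, as a subset of the model space. -/
def pastCone (x : M) : Set (EuclideanSpace ℝ (Fin (n + 1))) :=
  {v | v ≠ 0 → O.IsPastPointing (show TangentSpace (𝓡 (n + 1)) x from v)}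

/-- The past causal cone in the chart consists of the coordinates of the vectors that are zero or
past-pointing. -/
theorem mem_cone_coordMetric (ht : O.IsTimeFunction t) {x₀ : M}
    {y v : EuclideanSpace ℝ (Fin (n + 1))} (hy : y ∈ (extChartAt (𝓡 (n + 1)) x₀).target) :
    v ∈ (coordMetric ht x₀).cone y ↔
      chartDeriv n x₀ y v ∈ O.pastCone ((extChartAt (𝓡 (n + 1)) x₀).symm y) := by
  have h := past_iff ht (x := (extChartAt (𝓡 (n + 1)) x₀).symm y) (v := chartDeriv n x₀ y v)
  rw [← fderiv_comp_chart g ht.1 hy] at h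
  exact h.symm

end TimeOrientation

end LorentzianMetric

/-! ### The local causal relation of the manifold -/

theorem curveVelocity_of_mem_nhds {n : ℕ} {M : Type*} [TopologicalSpace M]
    [ChartedSpace (EuclideanSpace ℝ (Fin (n + 1))) M] {c : ℝ → M} {s : ℝ} {J : Set ℝ}
    (hJ : J ∈ 𝓝 s) :
    curveVelocity n c J s = curveVelocity n c univ s := by
  rw [curveVelocity, curveVelocity, mfderivWithin_univ, mfderivWithin_of_mem_nhds hJ]

namespace LorentzianMetric

variable {n : ℕ} {M : Type*} [TopologicalSpace M]
  [ChartedSpace (EuclideanSpace ℝ (Fin (n + 1))) M] [IsManifold (𝓡 (n + 1)) ∞ M]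
  {g : LorentzianMetric n M}

namespace TimeOrientation

variable {O : g.TimeOrientation} {t : M → ℝ}

theorem isPastCausalCurve_iff {c : ℝ → M} {J : Set ℝ} :
    O.IsPastCausalCurve c J ↔ ContMDiffOn 𝓘(ℝ, ℝ) (𝓡 (n + 1)) ∞ c J ∧
      ∀ s ∈ J, curveVelocity n c J s ∈ O.pastCone (c s) := Iff.rfl

/-- The velocity of a curve read in a chart. -/
theorem exists_hasDerivAt_chart {c : ℝ → M} {s : ℝ} {x₀ : M}
    (hc : MDifferentiableAt 𝓘(ℝ, ℝ) (𝓡 (n + 1)) c s)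
    (hs : c s ∈ (extChartAt (𝓡 (n + 1)) x₀).source) :
    ∃ v, HasDerivAt (fun u ↦ extChartAt (𝓡 (n + 1)) x₀ (c u)) v s ∧
      curveVelocity n c univ s = chartDeriv n x₀ (extChartAt (𝓡 (n + 1)) x₀ (c s)) v := by
  set φ := extChartAt (𝓡 (n + 1)) x₀ with hφ
  have h1 : MDifferentiableAt (𝓡 (n + 1)) 𝓘(ℝ, EuclideanSpace ℝ (Fin (n + 1))) φ (c s) :=
    mdifferentiableAt_extChartAt (by simpa [hφ] using hs)
  have h2 : MDifferentiableAt 𝓘(ℝ, ℝ) 𝓘(ℝ, EuclideanSpace ℝ (Fin (n + 1))) (fun u ↦ φ (c u)) s :=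
    h1.comp s hc
  have h3 : DifferentiableAt ℝ (fun u ↦ φ (c u)) s := mdifferentiableAt_iff_differentiableAt.1 h2
  have hy : φ (c s) ∈ φ.target := φ.map_source hs
  have h4 : MDifferentiableAt 𝓘(ℝ, EuclideanSpace ℝ (Fin (n + 1))) (𝓡 (n + 1)) φ.symm (φ (c s)) :=
    ((contMDiffOn_extChartAt_symm (I := 𝓡 (n + 1)) (n := ∞) x₀).contMDiffAt
      ((isOpen_extChartAt_target x₀).mem_nhds hy)).mdifferentiableAt (by simp)
  refine ⟨_, h3.hasDerivAt, ?_⟩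
  have h5 : c =ᶠ[𝓝 s] φ.symm ∘ fun u ↦ φ (c u) := by
    filter_upwards [hc.continuousAt.preimage_mem_nhds ((isOpen_extChartAt_source x₀).mem_nhds hs)]
      with u hu using (φ.left_inv hu).symm
  have h6 := h5.mfderiv_eq (I := 𝓘(ℝ, ℝ)) (I' := 𝓡 (n + 1))
  have h7 := mfderiv_comp s h4 h2
  rw [mfderiv_eq_fderiv] at h7
  have h8 : (mfderiv 𝓘(ℝ, ℝ) (𝓡 (n + 1)) c s : ℝ →L[ℝ] EuclideanSpace ℝ (Fin (n + 1))) 1 =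
      (mfderiv 𝓘(ℝ, ℝ) (𝓡 (n + 1)) (φ.symm ∘ fun u ↦ φ (c u)) s :
        ℝ →L[ℝ] EuclideanSpace ℝ (Fin (n + 1))) 1 := by rw [h6]; rfl
  rw [h7] at h8
  rw [curveVelocity, mfderivWithin_univ]
  exact h8

/-- A past-directed causal curve read in a chart. -/
theorem hasDerivAt_chart_of_isPastCausalCurve (ht : O.IsTimeFunction t) {c : ℝ → M} {a b s : ℝ}
    {x₀ : M} (hc : O.IsPastCausalCurve c (Icc a b)) (hs : s ∈ Ioo a b)
    (hx : c s ∈ (extChartAt (𝓡 (n + 1)) x₀).source) :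
    ∃ v ∈ (coordMetric ht x₀).cone (extChartAt (𝓡 (n + 1)) x₀ (c s)),
      HasDerivAt (fun u ↦ extChartAt (𝓡 (n + 1)) x₀ (c u)) v s := by
  have hJ : Icc a b ∈ 𝓝 s := Icc_mem_nhds hs.1 hs.2
  obtain ⟨v, hv, hv'⟩ := exists_hasDerivAt_chart
    ((hc.1.contMDiffAt hJ).mdifferentiableAt (by simp)) hx
  refine ⟨v, ?_, hv⟩
  rw [mem_cone_coordMetric ht ((extChartAt (𝓡 (n + 1)) x₀).map_source hx), ← hv',
    (extChartAt (𝓡 (n + 1)) x₀).left_inv hx, ← curveVelocity_of_mem_nhds hJ]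
  exact hc.2 s (Ioo_subset_Icc_self hs)

/-- A causal curve in a chart defines a past-directed causal curve in the manifold. -/
theorem isPastCausalCurve_chart_symm (ht : O.IsTimeFunction t)
    {c : ℝ → EuclideanSpace ℝ (Fin (n + 1))} {ε : ℝ} {x₀ : M} (hε : 0 < ε)
    (hc : ContDiffOn ℝ ∞ c (Icc 0 ε))
    (hcone : ∀ s ∈ Icc 0 ε, c s ∈ (coordMetric ht x₀).Ω ∧
      derivWithin c (Icc 0 ε) s ∈ (coordMetric ht x₀).cone (c s)) :
    O.IsPastCausalCurve (fun s ↦ (extChartAt (𝓡 (n + 1)) x₀).symm (c s)) (Icc 0 ε) := by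
  set φ := extChartAt (𝓡 (n + 1)) x₀ with hφ
  have hφs := contMDiffOn_extChartAt_symm (I := 𝓡 (n + 1)) (n := ∞) x₀
  rw [isPastCausalCurve_iff]
  refine ⟨hφs.comp (contMDiffOn_iff_contDiffOn.2 hc) fun s hs ↦ (hcone s hs).1, fun s hs ↦ ?_⟩
  obtain ⟨hmem, hder⟩ := hcone s hs
  rw [mem_cone_coordMetric ht hmem] at hder
  have h1 : MDifferentiableAt 𝓘(ℝ, EuclideanSpace ℝ (Fin (n + 1))) (𝓡 (n + 1)) φ.symm (c s) :=
    (hφs.contMDiffAt ((isOpen_extChartAt_target x₀).mem_nhds hmem)).mdifferentiableAt (by simp)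
  have h2 : MDifferentiableWithinAt 𝓘(ℝ, ℝ) 𝓘(ℝ, EuclideanSpace ℝ (Fin (n + 1))) c (Icc 0 ε) s :=
    mdifferentiableWithinAt_iff_differentiableWithinAt.2 (hc.differentiableOn (by simp) s hs)
  have h3 := mfderiv_comp_mfderivWithin s h1 h2
    (uniqueMDiffOn_iff_uniqueDiffOn.2 (uniqueDiffOn_Icc hε) s hs)
  have h4 : curveVelocity n (fun s ↦ φ.symm (c s)) (Icc 0 ε) s =
      chartDeriv n x₀ (c s) (derivWithin c (Icc 0 ε) s) := by
    rw [curveVelocity]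
    erw [h3]
    rw [mfderivWithin_eq_fderivWithin]
    rfl
  rw [h4]
  exact hder

variable (O) in
/-- The point `y` is reached from `z` by a past-directed causal curve that stays in `W`. -/
def PastJoined (W : Set M) (z y : M) : Prop :=
  ∃ (c : ℝ → M) (a b : ℝ), a < b ∧ O.IsPastCausalCurve c (Icc a b) ∧ MapsTo c (Icc a b) W ∧
    c a = z ∧ c b = y

/-- Every point has a neighbourhood in which the causal relation is closed and the time function
strictly monotone. -/
theorem exists_nhds_causal_closed (ht : O.IsTimeFunction t) (x₀ : M) :
    ∃ W ∈ 𝓝 x₀, ∀ z ∈ W, ∀ y ∈ W, (z, y) ∈ closure {q : M × M | O.PastJoined W q.1 q.2} →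
      y ∈ O.causalPast z ∧ (y ≠ z → t y < t z) := by
  set φ := extChartAt (𝓡 (n + 1)) x₀ with hφ
  obtain ⟨ρ, hρ, h, -⟩ := (coordMetric ht x₀).exists_ball_causal_closed
    (mem_extChartAt_target (I := 𝓡 (n + 1)) x₀)
  refine ⟨φ.source ∩ φ ⁻¹' Metric.ball (φ x₀) ρ, inter_mem (extChartAt_source_mem_nhds x₀)
    ((continuousAt_extChartAt x₀).preimage_mem_nhds (Metric.ball_mem_nhds _ hρ)),
    fun z hz y hy hcl ↦ ?_⟩
  have hcont : ContinuousAt (Prod.map φ φ) (z, y) :=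
    (continuousAt_extChartAt' (by simpa [hφ] using hz.1)).prodMap
      (continuousAt_extChartAt' (by simpa [hφ] using hy.1))
  have hmaps : MapsTo (Prod.map φ φ)
      {q : M × M | O.PastJoined (φ.source ∩ φ ⁻¹' Metric.ball (φ x₀) ρ) q.1 q.2}
      {q | (coordMetric ht x₀).CausallyJoined (Metric.ball (φ x₀) ρ) q.1 q.2} := by
    rintro ⟨z', y'⟩ ⟨c, a, b, hab, hc, hm, rfl, rfl⟩
    refine ⟨fun u ↦ φ (c u), a, b, hab, ?_, fun s hs ↦ ?_, fun s hs ↦ (hm hs).2, rfl, rfl⟩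
    · exact (continuousOn_extChartAt x₀).comp hc.1.continuousOn fun s hs ↦ (hm hs).1
    · exact hasDerivAt_chart_of_isPastCausalCurve ht hc hs (hm (Ioo_subset_Icc_self hs)).1
  obtain ⟨⟨c, ε, hε, hc, hc0, hcε, hcone⟩, hlt⟩ := h (φ z) hz.2 (φ y) hy.2
    (hcont.continuousWithinAt.mem_closure hcl hmaps)
  refine ⟨⟨_, 0, ε, hε, isPastCausalCurve_chart_symm ht hε hc hcone, ?_, ?_⟩, fun hne ↦ ?_⟩
  · rw [hc0]; exact φ.left_inv hz.1
  · rw [hcε]; exact φ.left_inv hy.1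
  · have h1 := hlt fun heq ↦ hne (φ.injOn hy.1 hz.1 heq)
    change t (φ.symm (φ y)) < t (φ.symm (φ z)) at h1
    rwa [φ.left_inv hy.1, φ.left_inv hz.1] at h1

theorem exists_mem_causalPast_lt (ht : O.IsTimeFunction t) (x₀ : M) :
    ∃ y ∈ O.causalPast x₀, t y < t x₀ := by
  set φ := extChartAt (𝓡 (n + 1)) x₀ with hφ
  obtain ⟨ρ, hρ, -, c, ε, hε, hc, hc0, hlt, hcone⟩ :=
    (coordMetric ht x₀).exists_ball_causal_closed (mem_extChartAt_target (I := 𝓡 (n + 1)) x₀)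
  have h0 : φ.symm (φ x₀) = x₀ := extChartAt_to_inv x₀
  refine ⟨φ.symm (c ε), ⟨_, 0, ε, hε, isPastCausalCurve_chart_symm ht hε hc hcone, ?_, rfl⟩, ?_⟩
  · rw [hc0]; exact h0
  · change t (φ.symm (c ε)) < t (φ.symm (φ x₀)) at hlt
    rwa [h0] at hlt

end TimeOrientation

end LorentzianMetric

/-! ### Joining and reparametrizing causal curves -/

/-- A smooth monotone function that is constant on `(-∞, 1/3]` and on `[2/3, ∞)`. -/
noncomputable def flatStep (a b s : ℝ) : ℝ := a + (b - a) * Real.smoothTransition (3 * s - 1)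

theorem contDiff_flatStep (a b : ℝ) : ContDiff ℝ ∞ (flatStep a b) :=
  contDiff_const.add (contDiff_const.mul (Real.smoothTransition.contDiff.comp
    ((contDiff_const.mul contDiff_id).sub contDiff_const)))

theorem flatStep_of_le {a b s : ℝ} (hs : s ≤ 1 / 3) : flatStep a b s = a := by
  rw [flatStep, Real.smoothTransition.zero_of_nonpos (by linarith)]
  ring

theorem flatStep_of_ge {a b s : ℝ} (hs : 2 / 3 ≤ s) : flatStep a b s = b := by
  rw [flatStep, Real.smoothTransition.one_of_one_le (by linarith)]
  ring

theorem monotone_flatStep {a b : ℝ} (hab : a ≤ b) : Monotone (flatStep a b) := fun s u hsu ↦ by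
  have := Real.smoothTransition.monotone (show 3 * s - 1 ≤ 3 * u - 1 by linarith)
  unfold flatStep
  have h : 0 ≤ b - a := by linarith
  gcongr

theorem flatStep_mem {a b : ℝ} (hab : a ≤ b) (s : ℝ) : flatStep a b s ∈ Icc a b := by
  have h0 := Real.smoothTransition.nonneg (3 * s - 1)
  have h1 := Real.smoothTransition.le_one (3 * s - 1)
  have h : 0 ≤ b - a := by linarith
  constructor <;> unfold flatStep <;> nlinarith

/-- A smooth monotone function that is constant on `(-∞, a + δ]` and the identity on
`[a + 2δ, ∞)`. -/
noncomputable def flatStart (a δ s : ℝ) : ℝ :=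
  a + (s - a) * Real.smoothTransition ((s - a) / δ - 1)

theorem contDiff_flatStart (a δ : ℝ) : ContDiff ℝ ∞ (flatStart a δ) :=
  contDiff_const.add ((contDiff_id.sub contDiff_const).mul (Real.smoothTransition.contDiff.comp
    (((contDiff_id.sub contDiff_const).div_const δ).sub contDiff_const)))

theorem flatStart_of_le {a δ s : ℝ} (hδ : 0 < δ) (hs : s ≤ a + δ) : flatStart a δ s = a := by
  rw [flatStart, Real.smoothTransition.zero_of_nonpos]
  · ring
  · rw [sub_nonpos, div_le_one hδ]; linarith

theorem flatStart_of_ge {a δ s : ℝ} (hδ : 0 < δ) (hs : a + 2 * δ ≤ s) : flatStart a δ s = s := by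
  rw [flatStart, Real.smoothTransition.one_of_one_le]
  · ring
  · rw [le_sub_iff_add_le, le_div_iff₀ hδ]; linarith

theorem monotone_flatStart {a δ : ℝ} (hδ : 0 < δ) : Monotone (flatStart a δ) := fun s u hsu ↦ by
  have hu0 := Real.smoothTransition.nonneg ((u - a) / δ - 1)
  rcases le_total s a with hs | hs
  · rw [flatStart_of_le hδ (by linarith)]
    rcases le_total u a with hu | hu
    · rw [flatStart_of_le hδ (by linarith)]
    · unfold flatStart
      have := mul_nonneg (sub_nonneg.2 hu) hu0
      linarith
  · unfold flatStart
    have h1 : Real.smoothTransition ((s - a) / δ - 1) ≤ Real.smoothTransition ((u - a) / δ - 1) :=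
      Real.smoothTransition.monotone (by gcongr)
    have h2 := Real.smoothTransition.nonneg ((s - a) / δ - 1)
    have := mul_le_mul (sub_le_sub_right hsu a) h1 h2 (by linarith)
    linarith

theorem le_flatStart {a δ : ℝ} (hδ : 0 < δ) (s : ℝ) : a ≤ flatStart a δ s := by
  rcases le_total s a with hs | hs
  · rw [flatStart_of_le hδ (by linarith)]
  · have := monotone_flatStart (a := a) hδ hs
    rwa [flatStart_of_le hδ (by linarith)] at this

theorem flatStart_le {a δ : ℝ} (hδ : 0 < δ) (s : ℝ) : flatStart a δ s ≤ max a s := by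
  rcases le_total s a with hs | hs
  · rw [flatStart_of_le hδ (by linarith)]
    exact le_max_left _ _
  · refine le_max_of_le_right ?_
    have h1 := Real.smoothTransition.le_one ((s - a) / δ - 1)
    unfold flatStart
    nlinarith

namespace LorentzianMetric

variable {n : ℕ} {M : Type*} [TopologicalSpace M]
  [ChartedSpace (EuclideanSpace ℝ (Fin (n + 1))) M] [IsManifold (𝓡 (n + 1)) ∞ M]
  {g : LorentzianMetric n M}

namespace TimeOrientation

variable {O : g.TimeOrientation} {t : M → ℝ}

variable (O) in
/-- The curve `c` is smooth at `s`, and its velocity at `s` is zero or past-pointing. -/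
def IsPastAt (c : ℝ → M) (s : ℝ) : Prop :=
  ContMDiffAt 𝓘(ℝ, ℝ) (𝓡 (n + 1)) ∞ c s ∧ curveVelocity n c univ s ∈ O.pastCone (c s)

theorem smul_mem_pastCone {x : M} {v : EuclideanSpace ℝ (Fin (n + 1))} (hv : v ∈ O.pastCone x)
    {r : ℝ} (hr : 0 ≤ r) : r • v ∈ O.pastCone x := by
  intro h0
  have hr0 : r ≠ 0 := fun h ↦ h0 (by rw [h, zero_smul])
  have hrpos : 0 < r := lt_of_le_of_ne hr hr0.symm
  obtain ⟨h1, h2, h3⟩ := hv fun h ↦ h0 (by rw [h, smul_zero])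
  refine ⟨h0, fun h ↦ h2 ?_, ?_⟩
  · have h' : 0 < g.val x (r • (show TangentSpace (𝓡 (n + 1)) x from v))
      (r • (show TangentSpace (𝓡 (n + 1)) x from v)) := h
    rw [map_smul, map_smul, smul_apply, smul_eq_mul, smul_eq_mul] at h'
    exact pos_of_mul_pos_right (pos_of_mul_pos_right h' hr) hr
  · change 0 < g.val x (O.field x) (r • (show TangentSpace (𝓡 (n + 1)) x from v))
    rw [map_smul, smul_eq_mul]
    exact mul_pos hrpos h3

theorem zero_mem_pastCone (x : M) : (0 : EuclideanSpace ℝ (Fin (n + 1))) ∈ O.pastCone x :=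
  fun h ↦ absurd rfl h

/-- Monotone smooth reparametrizations of past-directed causal curves. -/
theorem isPastAt_comp {c : ℝ → M} {J : Set ℝ} {ψ : ℝ → ℝ} {s : ℝ}
    (hc : ContMDiffWithinAt 𝓘(ℝ, ℝ) (𝓡 (n + 1)) ∞ c J (ψ s))
    (hv : curveVelocity n c J (ψ s) ∈ O.pastCone (c (ψ s))) (hψ : ContDiffAt ℝ ∞ ψ s)
    (hJ : ∀ᶠ u in 𝓝 s, ψ u ∈ J) (h0 : 0 ≤ deriv ψ s) : O.IsPastAt (c ∘ ψ) s := by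
  have hψ' : ContMDiffAt 𝓘(ℝ, ℝ) 𝓘(ℝ, ℝ) ∞ ψ s := hψ.contMDiffAt
  refine ⟨?_, ?_⟩
  · exact (hc.comp s (hψ'.contMDiffWithinAt (s := ψ ⁻¹' J)) fun u hu ↦ hu).contMDiffAt hJ
  · have h1 := (hc.mdifferentiableWithinAt (by simp)).hasMFDerivWithinAt
    have h2 : HasMFDerivAt 𝓘(ℝ, ℝ) 𝓘(ℝ, ℝ) ψ s (fderiv ℝ ψ s) :=
      (hψ.differentiableAt (by simp)).hasFDerivAt.hasMFDerivAt
    have h3 := (h1.comp s (h2.hasMFDerivWithinAt (s := ψ ⁻¹' J)) fun u hu ↦ hu).hasMFDerivAt hJ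
    have h4 : curveVelocity n (c ∘ ψ) univ s = deriv ψ s • curveVelocity n c J (ψ s) := by
      rw [curveVelocity, mfderivWithin_univ, h3.mfderiv, curveVelocity]
      change mfderivWithin 𝓘(ℝ, ℝ) (𝓡 (n + 1)) c J (ψ s) (fderiv ℝ ψ s 1) = _
      rw [fderiv_apply_one_eq_deriv]
      have : deriv ψ s = deriv ψ s • (1 : ℝ) := by simp
      conv_lhs => rw [this]
      exact map_smul _ _ _
    rw [h4]
    exact smul_mem_pastCone hv h0

theorem IsPastAt.comp {c : ℝ → M} {ψ : ℝ → ℝ} {s : ℝ} (hc : O.IsPastAt c (ψ s))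
    (hψ : ContDiffAt ℝ ∞ ψ s) (h0 : 0 ≤ deriv ψ s) : O.IsPastAt (c ∘ ψ) s :=
  isPastAt_comp hc.1 hc.2 hψ (Eventually.of_forall fun _ ↦ trivial) h0

theorem IsPastAt.congr {c c' : ℝ → M} {s : ℝ} (hc : O.IsPastAt c s) (h : c' =ᶠ[𝓝 s] c) :
    O.IsPastAt c' s := by
  refine ⟨hc.1.congr_of_eventuallyEq h, ?_⟩
  have h1 : curveVelocity n c' univ s = curveVelocity n c univ s := by
    rw [curveVelocity, curveVelocity, mfderivWithin_univ, mfderivWithin_univ, h.mfderiv_eq]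
    rfl
  rw [h1, h.eq_of_nhds]
  exact hc.2

theorem isPastCausalCurve_of_isPastAt {c : ℝ → M} {J : Set ℝ} (hJ : UniqueDiffOn ℝ J)
    (h : ∀ s ∈ J, O.IsPastAt c s) : O.IsPastCausalCurve c J := by
  rw [isPastCausalCurve_iff]
  refine ⟨fun s hs ↦ (h s hs).1.contMDiffWithinAt, fun s hs ↦ ?_⟩
  have h1 : curveVelocity n c J s = curveVelocity n c univ s := by
    rw [curveVelocity, curveVelocity, mfderivWithin_univ, mfderivWithin_eq_mfderiv
      (uniqueMDiffWithinAt_iff_uniqueDiffWithinAt.2 (hJ s hs))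
      ((h s hs).1.mdifferentiableAt (by simp))]
  rw [h1]
  exact (h s hs).2

theorem isPastAt_const (x : M) (s : ℝ) : O.IsPastAt (fun _ ↦ x) s := by
  refine ⟨contMDiffAt_const, ?_⟩
  have : curveVelocity n (fun _ : ℝ ↦ x) univ s = 0 := by
    rw [curveVelocity, mfderivWithin_univ, mfderiv_const]
    rfl
  rw [this]
  exact zero_mem_pastCone x

theorem IsPastCausalCurve.isPastAt {c : ℝ → M} {J : Set ℝ} {s : ℝ} (h : O.IsPastCausalCurve c J)
    (hJ : J ∈ 𝓝 s) : O.IsPastAt c s := by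
  refine ⟨h.1.contMDiffAt hJ, ?_⟩
  rw [← curveVelocity_of_mem_nhds hJ]
  exact h.2 s (mem_of_mem_nhds hJ)

/-- A past-directed causal curve can be parametrized by the line so that it rests near its ends. -/
theorem exists_flat_parametrization {c : ℝ → M} {a b : ℝ} (hab : a < b)
    (hc : O.IsPastCausalCurve c (Icc a b)) :
    ∃ k : ℝ → M, (∀ s, O.IsPastAt k s) ∧ (∀ s ≤ 1 / 3, k s = c a) ∧ (∀ s, 2 / 3 ≤ s → k s = c b) ∧
      ∀ s, k s ∈ c '' Icc a b := by
  refine ⟨c ∘ flatStep a b, fun s ↦ ?_, fun s hs ↦ ?_, fun s hs ↦ ?_, fun s ↦ ?_⟩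
  · exact isPastAt_comp (hc.1 _ (flatStep_mem hab.le s)) (hc.2 _ (flatStep_mem hab.le s))
      (contDiff_flatStep a b).contDiffAt (Eventually.of_forall (flatStep_mem hab.le))
      (monotone_flatStep hab.le).deriv_nonneg
  · rw [Function.comp_apply, flatStep_of_le hs]
  · rw [Function.comp_apply, flatStep_of_ge hs]
  · exact mem_image_of_mem c (flatStep_mem hab.le s)

/-- Infinitely many causal curves can be joined to a smooth causal curve. -/
theorem exists_curve_through {x : ℕ → M} (hx : ∀ i, x (i + 1) ∈ O.causalPast (x i)) :
    ∃ c : ℝ → M, (∀ s, O.IsPastAt c s) ∧ ∀ i : ℕ, c i = x i := by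
  have hk : ∀ i, ∃ k : ℝ → M, (∀ s, O.IsPastAt k s) ∧ (∀ s ≤ 1 / 3, k s = x i) ∧
      (∀ s, 2 / 3 ≤ s → k s = x (i + 1)) := fun i ↦ by
    obtain ⟨c, a, b, hab, hc, hca, hcb⟩ := hx i
    obtain ⟨k, h1, h2, h3, -⟩ := exists_flat_parametrization hab hc
    exact ⟨k, h1, fun s hs ↦ (h2 s hs).trans hca, fun s hs ↦ (h3 s hs).trans hcb⟩
  choose k hk1 hk2 hk3 using hk
  set c : ℝ → M := fun s ↦ k ⌊s⌋₊ (s - ⌊s⌋₊) with hc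
  -- near the integers the pieces are constant, so that they fit together
  have hloc : ∀ (i : ℕ) (u : ℝ), (i : ℝ) - 1 / 3 < u → u < i + 1 → c u = k i (u - i) := by
    intro i u h1 h2
    rcases le_or_gt (i : ℝ) u with h | h
    · have : ⌊u⌋₊ = i := (Nat.floor_eq_iff (i.cast_nonneg.trans h)).2 ⟨h, h2⟩
      simp only [hc, this]
    · cases i with
      | zero =>
        have : ⌊u⌋₊ = 0 := Nat.floor_of_nonpos (by simpa using h.le)
        simp only [hc, this]
      | succ j =>
        push_cast at h1 h
        have : ⌊u⌋₊ = j := (Nat.floor_eq_iff (by have := j.cast_nonneg (α := ℝ); linarith)).2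
          ⟨by linarith, h⟩
        simp only [hc, this]
        rw [hk3 j _ (by linarith), hk2 (j + 1) _ (by push_cast; linarith)]
  have hloc0 : ∀ u : ℝ, u < 1 → c u = k 0 (u - (0 : ℕ)) := fun u hu ↦ by
    have : ⌊u⌋₊ = 0 := Nat.floor_eq_zero.2 hu
    simp only [hc, this]
  have hshift : ∀ (i : ℕ) (s : ℝ), O.IsPastAt (fun u ↦ k i (u - i)) s := fun i s ↦ by
    refine IsPastAt.comp (c := k i) (ψ := fun u ↦ u - i) (hk1 i _)
      (contDiff_id.sub contDiff_const).contDiffAt ?_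
    simp
  refine ⟨c, fun s ↦ ?_, fun i ↦ ?_⟩
  · rcases lt_or_ge s 0 with hs | hs
    · refine (hshift 0 s).congr ?_
      filter_upwards [Iio_mem_nhds (show s < 1 by linarith)] with u hu using hloc0 u hu
    · refine (hshift ⌊s⌋₊ s).congr ?_
      have h1 := Nat.floor_le hs
      have h2 := Nat.lt_floor_add_one s
      filter_upwards [Ioo_mem_nhds (show (⌊s⌋₊ : ℝ) - 1 / 3 < s by linarith) h2] with u hu
        using hloc _ u hu.1 hu.2
  · rw [hloc i i (by linarith) (by linarith), sub_self, hk2 i 0 (by norm_num)]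

theorem mem_causalPast_of_isPastAt {c : ℝ → M} (hc : ∀ s, O.IsPastAt c s) {a b : ℝ} (hab : a < b) :
    c b ∈ O.causalPast (c a) :=
  ⟨c, a, b, hab, isPastCausalCurve_of_isPastAt (uniqueDiffOn_Icc hab) fun s _ ↦ hc s, rfl, rfl⟩

theorem mem_causalPast_self (x : M) : x ∈ O.causalPast x :=
  mem_causalPast_of_isPastAt (c := fun _ ↦ x) (isPastAt_const x) zero_lt_one

theorem causalPast_trans {x y z : M} (hy : y ∈ O.causalPast x) (hz : z ∈ O.causalPast y) :
    z ∈ O.causalPast x := by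
  obtain ⟨c, hc, hci⟩ := exists_curve_through
    (x := fun i ↦ if i = 0 then x else if i = 1 then y else z) (O := O) (fun i ↦ by
      rcases i with _ | _ | i
      · simpa using hy
      · simpa using hz
      · simpa using mem_causalPast_self z)
  have h0 := hci 0
  have h2 := hci 2
  simp only [Nat.cast_zero, if_true, Nat.cast_ofNat] at h0 h2
  rw [← h0, show z = c 2 by rw [h2]; simp]
  exact mem_causalPast_of_isPastAt hc (by norm_num)

/-- Time functions do not increase along past-directed causal curves. -/
theorem antitoneOn_of_isPastCausalCurve (ht : O.IsTimeFunction t) {c : ℝ → M} {a b : ℝ}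
    (hc : O.IsPastCausalCurve c (Icc a b)) : AntitoneOn (fun s ↦ t (c s)) (Icc a b) := by
  have hder : ∀ s ∈ Ioo a b, HasDerivAt (fun s ↦ t (c s))
      (g.val (c s) (g.grad t (c s)) (curveVelocity n c univ s)) s := fun s hs ↦ by
    have h1 := (hc.isPastAt (Icc_mem_nhds hs.1 hs.2)).1
    have h2 := ((ht.1 (c s)).mdifferentiableAt (by simp)).hasMFDerivAt.comp s
      (h1.mdifferentiableAt (by simp)).hasMFDerivAt
    have h3 := (show HasFDerivAt (fun s ↦ t (c s)) (_ : ℝ →L[ℝ] ℝ) s from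
      h2.hasFDerivAt).hasDerivAt
    rw [g.val_grad, curveVelocity, mfderivWithin_univ]
    exact h3
  refine antitoneOn_of_deriv_nonpos (convex_Icc a b)
    (ht.1.continuous.comp_continuousOn hc.1.continuousOn) (fun s hs ↦ ?_) (fun s hs ↦ ?_) <;>
    rw [interior_Icc] at hs
  · exact (hder s hs).differentiableAt.differentiableWithinAt
  · rw [(hder s hs).deriv]
    exact ((past_iff ht).1 (hc.isPastAt (Icc_mem_nhds hs.1 hs.2)).2).2

theorem le_of_mem_causalPast (ht : O.IsTimeFunction t) {x y : M} (h : y ∈ O.causalPast x) :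
    t y ≤ t x := by
  obtain ⟨c, a, b, hab, hc, rfl, rfl⟩ := h
  exact antitoneOn_of_isPastCausalCurve ht hc ⟨le_rfl, hab.le⟩ ⟨hab.le, le_rfl⟩ hab.le

theorem isPastCausalCurve_mono {c : ℝ → M} {J : Set ℝ} {a b : ℝ} (hab : a < b)
    (hc : O.IsPastCausalCurve c J) (hJ : Icc a b ⊆ J) : O.IsPastCausalCurve c (Icc a b) := by
  rw [isPastCausalCurve_iff] at hc ⊢
  refine ⟨hc.1.mono hJ, fun s hs ↦ ?_⟩
  have h1 : curveVelocity n c (Icc a b) s = curveVelocity n c J s := by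
    rw [curveVelocity, curveVelocity, mfderivWithin_subset hJ
      (uniqueMDiffWithinAt_iff_uniqueDiffWithinAt.2 (uniqueDiffOn_Icc hab s hs))
      ((hc.1 s (hJ hs)).mdifferentiableWithinAt (by simp))]
  rw [h1]
  exact hc.2 s (hJ hs)

theorem uniqueDiffOn_halfOpen {a : ℝ} {b : EReal} (hab : (a : EReal) < b) :
    UniqueDiffOn ℝ (halfOpen a b) := by
  obtain ⟨a', h1, h2⟩ := EReal.lt_iff_exists_real_btwn.1 hab
  refine uniqueDiffOn_convex ?_ ⟨(a + a') / 2, ?_⟩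
  · refine OrdConnected.convex ⟨fun s hs u hu w hw ↦ ⟨hs.1.trans hw.1, ?_⟩⟩
    exact (EReal.coe_le_coe_iff.2 hw.2).trans_lt hu.2
  · have h1' : a < a' := EReal.coe_lt_coe_iff.1 h1
    have hsub : Ioo a a' ⊆ halfOpen a b := fun s hs ↦
      ⟨hs.1.le, (EReal.coe_lt_coe_iff.2 hs.2).trans h2⟩
    refine interior_mono hsub ?_
    rw [interior_Ioo]
    constructor <;> linarith

/-- A causal curve from `p` to `x` followed by a past-inextendible curve from `x`. -/
theorem exists_halfOpen_concat {p x : M} (hx : x ∈ O.causalPast p) {c : ℝ → M} {a : ℝ} {b : EReal}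
    (hab : (a : EReal) < b) (hc : O.IsPastCausalCurve c (halfOpen a b)) (hlim : HasNoLimitAt c b)
    (hca : c a = x) :
    ∃ k : ℝ → M, ((a - 1 : ℝ) : EReal) < b ∧ O.IsPastCausalCurve k (halfOpen (a - 1) b) ∧
      HasNoLimitAt k b ∧ k (a - 1) = p ∧
      ∀ s ∈ halfOpen (a - 1) b, x ∈ O.causalPast (k s) ∨ ∃ u ∈ halfOpen a b, k s = c u := by
  obtain ⟨c₁, a₁, b₁, hab₁, hc₁, hca₁, hcb₁⟩ := hx
  obtain ⟨k₁, hk₁, hk₁a, hk₁b, hk₁m⟩ := exists_flat_parametrization hab₁ hc₁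
  obtain ⟨a', ha', ha'b⟩ := EReal.lt_iff_exists_real_btwn.1 hab
  replace ha' : a < a' := EReal.coe_lt_coe_iff.1 ha'
  set δ := (a' - a) / 2 with hδdef
  have hδ : 0 < δ := by simp only [hδdef]; linarith
  have hab1 : ((a - 1 : ℝ) : EReal) < b :=
    (EReal.coe_lt_coe_iff.2 (by linarith : a - 1 < a)).trans hab
  have hψ : ∀ s : ℝ, (s : EReal) < b → flatStart a δ s ∈ halfOpen a b := fun s hs ↦ by
    refine ⟨le_flatStart hδ s, (EReal.coe_le_coe_iff.2 (flatStart_le hδ s)).trans_lt ?_⟩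
    rcases max_cases a s with h | h <;> rw [h.1] <;> assumption
  have hk₂ : ∀ s : ℝ, (s : EReal) < b → O.IsPastAt (c ∘ flatStart a δ) s := fun s hs ↦ by
    refine isPastAt_comp (hc.1 _ (hψ s hs)) (hc.2 _ (hψ s hs)) (contDiff_flatStart a δ).contDiffAt
      ?_ (monotone_flatStart hδ).deriv_nonneg
    have hopen : IsOpen {u : ℝ | (u : EReal) < b} :=
      isOpen_Iio.preimage continuous_coe_real_ereal
    filter_upwards [hopen.mem_nhds hs] with u hu using hψ u hu
  have hk₁' : ∀ s, O.IsPastAt (fun u ↦ k₁ (u - (a - 1))) s := fun s ↦ by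
    refine IsPastAt.comp (c := k₁) (ψ := fun u ↦ u - (a - 1)) (hk₁ _)
      (contDiff_id.sub contDiff_const).contDiffAt ?_
    simp
  set k : ℝ → M := fun s ↦ if s < a then k₁ (s - (a - 1)) else c (flatStart a δ s) with hk
  have hkright : ∀ u, a - 1 / 3 < u → k u = c (flatStart a δ u) := fun u hu ↦ by
    by_cases h : u < a
    · simp only [hk, h, if_true]
      rw [hk₁b _ (by linarith), hcb₁, flatStart_of_le hδ (by linarith), hca]
    · simp only [hk, h, if_false]
  refine ⟨k, hab1, isPastCausalCurve_of_isPastAt (uniqueDiffOn_halfOpen hab1) fun s hs ↦ ?_, ?_, ?_,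
    fun s hs ↦ ?_⟩
  · rcases lt_or_ge s a with h | h
    · refine (hk₁' s).congr ?_
      filter_upwards [Iio_mem_nhds h] with u hu
      simp only [hk, mem_Iio.1 hu, if_true]
    · refine (hk₂ s hs.2).congr ?_
      filter_upwards [Ioi_mem_nhds (show a - 1 / 3 < s by linarith)] with u hu using hkright u hu
  · rintro ⟨q, hq⟩
    refine hlim ⟨q, hq.congr' ?_⟩
    have h1 : ∀ᶠ s : EReal in 𝓝[<] b, (a' : EReal) < s :=
      mem_nhdsWithin_of_mem_nhds (Ioi_mem_nhds ha'b)
    filter_upwards [preimage_mem_comap h1] with s hs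
    have hs' : a' < s := EReal.coe_lt_coe_iff.1 hs
    rw [hkright s (by linarith), flatStart_of_ge hδ (by simp only [hδdef]; linarith)]
  · simp only [hk, show a - 1 < a by linarith, if_true]
    rw [hk₁a _ (by linarith), hca₁]
  · by_cases h : s < a
    · left
      obtain ⟨u, hu, hku⟩ := hk₁m (s - (a - 1))
      have h1 : k s = c₁ u := by simp only [hk, h, if_true, hku]
      rw [h1, ← hcb₁]
      rcases hu.2.lt_or_eq with hlt | heq
      · exact ⟨c₁, u, b₁, hlt, isPastCausalCurve_mono hlt hc₁ (Icc_subset_Icc_left hu.1), rfl, rfl⟩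
      · rw [heq]; exact mem_causalPast_self _
    · exact Or.inr ⟨_, hψ s hs.2, by simp only [hk, h, if_false]⟩

end TimeOrientation

end LorentzianMetric

/-! ### Domains of dependence of time slices -/

namespace LorentzianMetric

variable {n : ℕ} {M : Type*} [TopologicalSpace M]
  [ChartedSpace (EuclideanSpace ℝ (Fin (n + 1))) M] [IsManifold (𝓡 (n + 1)) ∞ M]
  {g : LorentzianMetric n M}

namespace TimeOrientation

variable {O : g.TimeOrientation} {t : M → ℝ}

/-- If every point of a closed set `B` in the past of `p` has an earlier point of `B` in its past,
then a past-inextendible causal curve from `p` passes through infinitely many points of `B`. -/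
theorem exists_inextendible_curve_through (ht : O.IsTimeFunction t) {B : Set M} (hB : IsClosed B)
    {p : M} (hp : p ∈ B)
    (hstep : ∀ x ∈ B, x ∈ O.causalPast p → ∃ x' ∈ B, x' ∈ O.causalPast x ∧ t x' < t x) :
    ∃ c : ℝ → M, (∀ s, O.IsPastAt c s) ∧ c 0 = p ∧ (∀ i : ℕ, c i ∈ B) ∧
      (∀ i : ℕ, t (c (i + 1 : ℕ)) < t (c i)) ∧ HasNoLimitAt c ⊤ := by
  set f : M → ℝ := fun x ↦ Real.arctan (t x) with hf
  have hfcont : Continuous f := Real.continuous_arctan.comp ht.1.continuous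
  have hlt : ∀ x y, f x < f y ↔ t x < t y := fun x y ↦ Real.arctan_strictMono.lt_iff_lt
  set m : M → ℝ := fun x ↦ sInf (f '' (B ∩ O.causalPast x)) with hm
  have hm_le : ∀ x, ∀ y ∈ B, y ∈ O.causalPast x → m x ≤ f y := fun x y hy hyx ↦
    csInf_le ⟨-(Real.pi / 2), by rintro _ ⟨z, -, rfl⟩; exact (Real.neg_pi_div_two_lt_arctan _).le⟩
      ⟨y, ⟨hy, hyx⟩, rfl⟩
  -- each step gains at least half of the possible decrease of `arctan ∘ t`
  have hnext : ∀ x : {x // x ∈ B ∧ x ∈ O.causalPast p}, ∃ x' : {x // x ∈ B ∧ x ∈ O.causalPast p},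
      x'.1 ∈ O.causalPast x.1 ∧ t x'.1 < t x.1 ∧ f x'.1 < (f x.1 + m x.1) / 2 := by
    rintro ⟨x, hxB, hxp⟩
    obtain ⟨y, hyB, hyx, hyt⟩ := hstep x hxB hxp
    have h1 := hm_le x y hyB hyx
    have h2 := (hlt y x).2 hyt
    obtain ⟨_, ⟨z, ⟨hzB, hzx⟩, rfl⟩, hz⟩ := exists_lt_of_csInf_lt (s := f '' (B ∩ O.causalPast x))
      ⟨_, y, ⟨hyB, hyx⟩, rfl⟩ (show m x < (f x + m x) / 2 by linarith)
    exact ⟨⟨z, hzB, causalPast_trans hxp hzx⟩, hzx, (hlt z x).1 (by linarith), hz⟩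
  choose nxt hnxt1 hnxt2 hnxt3 using hnext
  set x : ℕ → {x // x ∈ B ∧ x ∈ O.causalPast p} :=
    fun i ↦ nxt^[i] ⟨p, hp, mem_causalPast_self p⟩ with hx
  have hxs : ∀ i, x (i + 1) = nxt (x i) := fun i ↦ Function.iterate_succ_apply' nxt i _
  obtain ⟨c, hc, hcx⟩ := exists_curve_through (x := fun i ↦ (x i).1) (O := O)
    fun i ↦ by rw [hxs]; exact hnxt1 _
  refine ⟨c, hc, ?_, fun i ↦ ?_, fun i ↦ ?_, ?_⟩
  · rw [← Nat.cast_zero (R := ℝ), hcx]; rfl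
  · rw [hcx]; exact (x i).2.1
  · rw [hcx, hcx, hxs]; exact hnxt2 _
  rintro ⟨q, hq⟩
  have hle : (atTop : Filter ℝ) ≤ comap (fun s : ℝ ↦ (s : EReal)) (𝓝[<] ⊤) :=
    tendsto_iff_comap.1 (tendsto_nhdsWithin_iff.2 ⟨EReal.tendsto_coe_atTop,
      Eventually.of_forall fun s ↦ EReal.coe_lt_top s⟩)
  replace hq : Tendsto c atTop (𝓝 q) := hq.mono_left hle
  have hqn : Tendsto (fun i : ℕ ↦ (x i).1) atTop (𝓝 q) := by
    refine (hq.comp tendsto_natCast_atTop_atTop).congr fun i ↦ hcx i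
  have hqB : q ∈ B := hB.mem_of_tendsto hqn (Eventually.of_forall fun i ↦ (x i).2.1)
  obtain ⟨W, hW, hcl⟩ := exists_nhds_causal_closed ht q
  obtain ⟨s₀, hs₀⟩ := eventually_atTop.1 (hq.eventually_mem hW)
  have hpast : ∀ i : ℕ, s₀ ≤ i → q ∈ O.causalPast (x i).1 := fun i hi ↦ by
    refine (hcl _ (by rw [← hcx]; exact hs₀ _ hi) q (mem_of_mem_nhds hW) ?_).1
    refine mem_closure_of_tendsto (tendsto_const_nhds.prodMk_nhds hqn)
      ((eventually_gt_atTop i).mono fun j hj ↦ ?_)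
    have hij : (i : ℝ) < j := by exact_mod_cast hj
    exact ⟨c, i, j, hij, isPastCausalCurve_of_isPastAt (uniqueDiffOn_Icc hij) fun s _ ↦ hc s,
      fun s hs ↦ hs₀ s (hi.trans hs.1), hcx i, hcx j⟩
  obtain ⟨i₀, hi₀⟩ := exists_nat_ge s₀
  obtain ⟨q', hq'B, hq'q, hq't⟩ :=
    hstep q hqB (causalPast_trans (x i₀).2.2 (hpast i₀ hi₀))
  have hfq := (hfcont.tendsto q).comp hqn
  have h1 : f q ≤ (f q + f q') / 2 := by
    refine le_of_tendsto_of_tendsto (hfq.comp (tendsto_add_atTop_nat 1))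
      ((hfq.add_const (f q')).div_const 2) ((eventually_ge_atTop i₀).mono fun i hi ↦ ?_)
    have h2 := hnxt3 (x i)
    have h3 := hm_le (x i).1 q' hq'B
      (causalPast_trans (hpast i (hi₀.trans (by exact_mod_cast hi))) hq'q)
    rw [← hxs] at h2
    simp only [Function.comp_apply]
    linarith
  have h2 := (hlt q' q).2 hq't
  linarith

theorem isPastCausalCurve_halfOpen {c : ℝ → M} (hc : ∀ s, O.IsPastAt c s) :
    O.IsPastCausalCurve c (halfOpen 0 ⊤) :=
  isPastCausalCurve_of_isPastAt (uniqueDiffOn_halfOpen (EReal.coe_lt_top 0)) fun s _ ↦ hc s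

/-- The future domain of dependence of a level set of a time function lies in its future. -/
theorem le_of_mem_futureDomainOfDependence (ht : O.IsTimeFunction t) {q : M} {τ : ℝ}
    (hq : q ∈ O.futureDomainOfDependence (t ⁻¹' {τ})) : τ ≤ t q := by
  by_contra! hlt
  obtain ⟨c, hc, hc0, -, -, hlim⟩ := exists_inextendible_curve_through ht isClosed_univ (mem_univ q)
    fun x _ _ ↦ (exists_mem_causalPast_lt ht x).imp fun y hy ↦ ⟨mem_univ y, hy⟩
  obtain ⟨s, hs, hsS⟩ := hq c 0 ⊤ (EReal.coe_lt_top 0) (isPastCausalCurve_halfOpen hc) hlim hc0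
  have hsS' : t (c s) = τ := hsS
  rcases hs.1.lt_or_eq with h | h
  · have := le_of_mem_causalPast ht (mem_causalPast_of_isPastAt hc h)
    rw [hc0] at this
    linarith
  · rw [← h, hc0] at hsS'
    linarith

/-- A point in the past of a point of the future domain of dependence of a level set of a time
function lies in this domain, unless it is beyond the level set. -/
theorem mem_futureDomainOfDependence_of_mem_causalPast (ht : O.IsTimeFunction t) {p x : M} {τ : ℝ}
    (hp : p ∈ O.futureDomainOfDependence (t ⁻¹' {τ})) (hx : x ∈ O.causalPast p) (hτ : τ ≤ t x) :
    x ∈ O.futureDomainOfDependence (t ⁻¹' {τ}) := by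
  intro c a b hab hc hlim hca
  obtain ⟨k, hab', hk, hklim, hkp, hkc⟩ := exists_halfOpen_concat hx hab hc hlim hca
  obtain ⟨s, hs, hsS⟩ := hp k (a - 1) b hab' hk hklim hkp
  rcases hkc s hs with h | ⟨u, hu, hku⟩
  · refine ⟨a, ⟨le_rfl, hab⟩, ?_⟩
    have hsS' : t (k s) = τ := hsS
    have := le_of_mem_causalPast ht h
    rw [hca]
    exact le_antisymm (by linarith) hτ
  · exact ⟨u, hu, hku ▸ hsS⟩

/-- A causal curve that leaves a closed set `C` has an initial piece in `C` that ends on the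
frontier of `C`. -/
theorem exists_mem_frontier {C W : Set M} (hC : IsClosed C) (hCW : C ⊆ W) {z q : M}
    (hz : z ∈ interior C) (hq : q ∉ C) (hqz : q ∈ O.causalPast z) :
    ∃ y ∈ frontier C, O.PastJoined W z y ∧ q ∈ O.causalPast y := by
  obtain ⟨c, a, b, hab, hc, rfl, rfl⟩ := hqz
  have hcont := hc.1.continuousOn
  have hmeet : ∀ u ∈ Icc a b, c u ∉ C → ∃ v ∈ Icc a u, c v ∈ frontier C := fun u hu huC ↦ by
    have h1 : IsPreconnected (c '' Icc a u) :=
      isPreconnected_Icc.image c (hcont.mono (Icc_subset_Icc_right hu.2))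
    by_contra! hno
    obtain ⟨y, -, hy1, hy2⟩ := h1 (interior C) Cᶜ isOpen_interior hC.isOpen_compl
      (by
        rintro _ ⟨v, hv, rfl⟩
        by_contra h
        rw [mem_union, not_or, notMem_compl_iff] at h
        exact hno v hv ⟨subset_closure h.2, h.1⟩)
      ⟨c a, mem_image_of_mem c ⟨le_rfl, hu.1⟩, hz⟩
      ⟨c u, mem_image_of_mem c ⟨hu.1, le_rfl⟩, huC⟩
    exact hy2 (interior_subset hy1)
  have hcpt : IsCompact (Icc a b ∩ c ⁻¹' frontier C) :=
    isCompact_Icc.of_isClosed_subset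
      (hcont.preimage_isClosed_of_isClosed isClosed_Icc isClosed_frontier) inter_subset_left
  obtain ⟨s, ⟨hs, hsC⟩, hmin⟩ := hcpt.exists_isLeast (hmeet b ⟨hab.le, le_rfl⟩ hq)
  have has : a < s := hs.1.lt_of_ne fun h ↦ hsC.2 (h ▸ hz)
  have hsb : s < b := hs.2.lt_of_ne fun h ↦ hq (h ▸ hC.frontier_subset hsC)
  refine ⟨c s, hsC, ⟨c, a, s, has, isPastCausalCurve_mono has hc (Icc_subset_Icc_right hs.2),
    fun u hu ↦ hCW ?_, rfl, rfl⟩,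
    ⟨c, s, b, hsb, isPastCausalCurve_mono hsb hc (Icc_subset_Icc_left hs.1), rfl, rfl⟩⟩
  by_contra huC
  obtain ⟨v, hv, hvC⟩ := hmeet u ⟨hu.1, hu.2.trans hs.2⟩ huC
  have h1 : s ≤ v := hmin ⟨⟨hv.1, hv.2.trans (hu.2.trans hs.2)⟩, hvC⟩
  have h2 : u = s := le_antisymm hu.2 (h1.trans hv.2)
  exact huC (h2 ▸ hC.frontier_subset hsC)

variable (O) in
/-- The points `x` such that `𝓤`-many points lie in the past of any neighbourhood of `x`. -/
def limitFuture (𝓤 : Ultrafilter M) : Set M :=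
  {x | ∀ N ∈ 𝓝 x, {q | ∃ z ∈ N, q ∈ O.causalPast z} ∈ 𝓤}

theorem isClosed_limitFuture (𝓤 : Ultrafilter M) : IsClosed (O.limitFuture 𝓤) := by
  refine isClosed_of_closure_subset fun x hx N hN ↦ ?_
  obtain ⟨y, hy, hyB⟩ := mem_closure_iff_nhds.1 hx _ (interior_mem_nhds.2 hN)
  exact hyB N (mem_interior_iff_mem_nhds.1 hy)

/-- Unless `𝓤` converges to `x`, the causal curves from points near `x` to `𝓤`-many points leave a
small compact neighbourhood of `x`, and their exit points have a limit `x'`. -/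
theorem exists_lt_mem_limitFuture [T2Space M] [LocallyCompactSpace M] (ht : O.IsTimeFunction t)
    {𝓤 : Ultrafilter M} {x : M} (hx : x ∈ O.limitFuture 𝓤) (hU : ¬ (𝓤 : Filter M) ≤ 𝓝 x) :
    ∃ x' ∈ O.limitFuture 𝓤, x' ∈ O.causalPast x ∧ t x' < t x := by
  obtain ⟨W, hW, hcl⟩ := exists_nhds_causal_closed ht x
  obtain ⟨N, hN, hNU⟩ := Filter.not_le.1 hU
  obtain ⟨C, hCx, hCsub, hC⟩ := local_compact_nhds (inter_mem hW hN)
  have hCU : Cᶜ ∈ 𝓤 := Ultrafilter.compl_mem_iff_notMem.2 fun h ↦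
    hNU (mem_of_superset h (hCsub.trans inter_subset_right))
  have hCW : C ⊆ W := hCsub.trans inter_subset_left
  set F : Filter (M × M) := (𝓝 x ×ˢ (𝓤 : Filter M)) ⊓ 𝓟 {w | w.2 ∈ O.causalPast w.1} with hF
  have hne : F.NeBot := by
    refine inf_principal_neBot_iff.2 fun U hU ↦ ?_
    obtain ⟨A, hA, B, hB, hAB⟩ := mem_prod_iff.1 hU
    obtain ⟨q, hqB, z, hz, hqz⟩ := 𝓤.nonempty_of_mem (inter_mem hB (hx A hA))
    exact ⟨(z, q), hAB ⟨hz, hqB⟩, hqz⟩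
  set 𝓥 : Ultrafilter (M × M) := Ultrafilter.of F with h𝓥
  have hVF : (𝓥 : Filter (M × M)) ≤ F := Ultrafilter.of_le F
  have hV1 : Tendsto Prod.fst (𝓥 : Filter (M × M)) (𝓝 x) :=
    tendsto_fst.mono_left (hVF.trans inf_le_left)
  have hV2 : Tendsto Prod.snd (𝓥 : Filter (M × M)) 𝓤 :=
    tendsto_snd.mono_left (hVF.trans inf_le_left)
  have hexit : ∀ w : M × M, ∃ y, w.1 ∈ interior C → w.2 ∉ C → w.2 ∈ O.causalPast w.1 →
      y ∈ frontier C ∧ O.PastJoined W w.1 y ∧ w.2 ∈ O.causalPast y := fun w ↦ by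
    by_cases h : w.1 ∈ interior C ∧ w.2 ∉ C ∧ w.2 ∈ O.causalPast w.1
    · obtain ⟨y, hy⟩ := exists_mem_frontier hC.isClosed hCW h.1 h.2.1 h.2.2
      exact ⟨y, fun _ _ _ ↦ hy⟩
    · exact ⟨x, fun h1 h2 h3 ↦ absurd ⟨h1, h2, h3⟩ h⟩
  choose Y hY using hexit
  have hYev : ∀ᶠ w in (𝓥 : Filter (M × M)),
      Y w ∈ frontier C ∧ O.PastJoined W w.1 (Y w) ∧ w.2 ∈ O.causalPast (Y w) := by
    filter_upwards [hV1.eventually_mem (interior_mem_nhds.2 hCx), hV2.eventually_mem hCU,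
      hVF (mem_inf_of_right (mem_principal_self _))] with w h1 h2 h3 using hY w h1 h2 h3
  obtain ⟨x', hx', hYx'⟩ := isCompact_iff_ultrafilter_le_nhds.1
    (hC.of_isClosed_subset isClosed_frontier hC.isClosed.frontier_subset) (𝓥.map Y)
    (le_principal_iff.2 (hYev.mono fun w hw ↦ hw.1))
  replace hYx' : Tendsto Y (𝓥 : Filter (M × M)) (𝓝 x') := hYx'
  obtain ⟨hpast, hlt⟩ := hcl x (mem_of_mem_nhds hW) x' (hCW (hC.isClosed.frontier_subset hx'))
    (mem_closure_of_tendsto (hV1.prodMk_nhds hYx') (hYev.mono fun w hw ↦ hw.2.1))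
  refine ⟨x', fun A hA ↦ ?_, hpast, hlt fun h ↦ hx'.2 (h ▸ mem_interior_iff_mem_nhds.2 hCx)⟩
  by_contra hcon
  have h1 := hV2.eventually_mem (Ultrafilter.compl_mem_iff_notMem.2 hcon)
  obtain ⟨w, h2, h3, h4⟩ := (h1.and ((hYx'.eventually_mem hA).and hYev)).exists
  exact h2 ⟨Y w, h3, h4.2.2⟩

theorem isCompact_futureDomainOfDependence_inter_causalPast [T2Space M] [LocallyCompactSpace M]
    (ht : O.IsTimeFunction t) {τ : ℝ} {p : M}
    (hp : p ∈ O.futureDomainOfDependence (t ⁻¹' {τ})) :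
    IsCompact (O.futureDomainOfDependence (t ⁻¹' {τ}) ∩ O.causalPast p) := by
  refine isCompact_iff_ultrafilter_le_nhds.2 fun 𝓤 h𝓤 ↦ ?_
  rw [le_principal_iff] at h𝓤
  by_contra! hno
  have hpB : p ∈ O.limitFuture 𝓤 := fun N hN ↦
    mem_of_superset h𝓤 fun q hq ↦ ⟨p, mem_of_mem_nhds hN, hq.2⟩
  have hBτ : ∀ x ∈ O.limitFuture 𝓤, τ ≤ t x := fun x hx ↦ by
    by_contra! hlt
    obtain ⟨q, ⟨hqD, -⟩, z, hz, hqz⟩ := 𝓤.nonempty_of_mem (inter_mem h𝓤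
      (hx _ ((isOpen_Iio.preimage ht.1.continuous).mem_nhds hlt)))
    have h1 := le_of_mem_futureDomainOfDependence ht hqD
    have h2 := le_of_mem_causalPast ht hqz
    have h3 : t z < τ := hz
    linarith
  obtain ⟨c, hc, hc0, hcB, hclt, hlim⟩ := exists_inextendible_curve_through ht
    (isClosed_limitFuture 𝓤) hpB fun x hx hxp ↦ exists_lt_mem_limitFuture ht hx
      (hno x ⟨mem_futureDomainOfDependence_of_mem_causalPast ht hp hxp (hBτ x hx), hxp⟩)
  obtain ⟨s, -, hsS⟩ := hp c 0 ⊤ (EReal.coe_lt_top 0) (isPastCausalCurve_halfOpen hc) hlim hc0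
  have hsS' : t (c s) = τ := hsS
  obtain ⟨i, hi⟩ := exists_nat_gt s
  have h1 := le_of_mem_causalPast ht (mem_causalPast_of_isPastAt hc hi)
  have h2 := hclt i
  have h3 := hBτ _ (hcB (i + 1))
  linarith

end TimeOrientation

end LorentzianMetric

end

theorem mainTheorem3 (n : ℕ) {M : Type*} [TopologicalSpace M] [T2Space M]
    [SecondCountableTopology M] [ChartedSpace (EuclideanSpace ℝ (Fin (n + 1))) M]
    [IsManifold (𝓡 (n + 1)) ∞ M] (g : LorentzianMetric n M) (O : g.TimeOrientation)
    (hM : O.IsGloballyHyperbolic) (S : Set M) (hS : O.IsTimeSlice S)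
    (p : M) (hp : p ∈ O.futureDomainOfDependence S) :
    IsCompact (O.futureDomainOfDependence S ∩ O.causalPast p) := by
  obtain ⟨t, ht, τ, -, rfl⟩ := hS
  have : LocallyCompactSpace M :=
    ChartedSpace.locallyCompactSpace (EuclideanSpace ℝ (Fin (n + 1))) M
  exact LorentzianMetric.TimeOrientation.isCompact_futureDomainOfDependence_inter_causalPast ht hp
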